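/- **Setting.** Let $L$ be a countable, computably given first-order language: its constants, its function symbols (of positive arity) and its relation symbols form decidable subsets of $\mathbb N$, and arities are computable; the variables are indexed by $\mathbb N$, and there is in addition a binary similarity symbol $\approx$. The formulas of $\mathrm{RPL}\forall$ are built from the truth constants $\bar r$ ($r\in\mathbb Q\cap[0,1]$) and from atomic formulas by $\to$ and $\forall$. Truth degrees lie in $[0,1]$, with $0$ the highest degree of truth: $\bar r$ has degree $r$, $\varphi\to\psi$ has degree $\max(\|\psi\|-\|\varphi\|,0)$, and $\forall$ is the supremum. Put $\bot:=\bar 1$, $\neg\varphi:=\varphi\to\bot$, $\varphi\oplus\psi:=\neg(\varphi\to\neg\psi)$, $\varphi\leftrightarrow\psi:=(\varphi\to\psi)\oplus(\psi\to\varphi)$, $\exists x\,\varphi:=\neg\forall x\,\neg\varphi$. The axioms are - $\varphi\to(\psi\to\varphi)$, $\ (\varphi\to\psi)\to((\psi\to\sigma)\to(\varphi\to\sigma))$, $\ ((\varphi\to\psi)\to\psi)\to((\psi\to\varphi)\to\varphi)$, $\ (\neg\varphi\to\neg\psi)\to(\psi\to\varphi)$; - $\forall x\,\varphi\to\varphi[t/x]$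 for $t$ free for $x$ in $\varphi$, and $\forall x(\varphi\to\psi)\to(\varphi\to\forall x\,\psi)$ for $x$ not free in $\varphi$; - $(\bar r\to\bar s)\leftrightarrow\overline{\max(s-r,0)}$; - $x\approx x$, $\ x\approx y\to y\approx x$, $\ (x\approx y\oplus y\approx z)\to x\approx z$; and the rules are modus ponens and generalization. For a theory (set of formulas) $T$ write $T\vdash\varphi$ for provability from $T$. The provability degree is $|\varphi|_T=\inf\{r\in\mathbb Q\cap[0,1]: T\vdash\bar r\to\varphi\}$. $T$ is *consistent* if $T\nvdash\bot$; *linear-complete* if for all sentences $\varphi,\psi$, $T\vdash\varphi\to\psi$ or $T\vdash\psi\to\varphi$; *Henkin* if for every sentence $\exists x\,\varphi$ with $T\vdash\exists x\,\varphi$ there is a constant $c$ with $T\vdash\varphi[c/x]$; *computably axiomatizable* if its set of axioms is computably enumerable. In a standard structure $M$ (non-empty universe; $\approx$ and the relations take values in $[0,1]$), $\|\varphi\|_M$ is the supremum of the truth degrees of $\varphi$ over all evaluations, and $M\models T$ means that every $\varphi\in T$ has degree $0$ under every evaluation. $M$ is *decidable* with respect to an injective numbering of its universe by natural numbers if the set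 of the numbers is decidable, the interpretations of constants and function symbols are computable, uniformly in the symbol, and the elementary diagram is computably enumerable. The elementary diagram is the set of the pairs of a sentence $\varphi$ with parameters from $M$ and an interval $[p,q]$, $p,q\in\mathbb Q\cap[0,1]$, with $\|\varphi\|_M$ in the interior of $[p,q]$ relative to $[0,1]$. **Theorem 3.5.** Let $T$ be a consistent, linear-complete, computably axiomatizable Henkin theory in $\mathrm{RPL}\forall$, in the language $L$. Then $T$ has a decidable model. More precisely: 1. $T$ has a model $M$ whose universe is the set of closed terms, in which every closed term denotes itself, $\approx$ is interpreted by the pseudo-metric $\rho(s,t)=|s\approx t|_T$, and $\|\varphi\|_M=|\varphi|_T$ for every sentence $\varphi$. $M$ is decidable with respect to the Gödel numbering of closed terms. 2. Suppose that $L$ has no function symbols, or that closed terms at distance $0$ are not distinguished by the symbols of $L$: whenever $s_1,t_1,\dots,s_n,t_n$ are closed terms with $|s_i\approx t_i|_T=0$ for all $i$, then $|R(\vec s)|_T=|R(\vec t)|_T$ for each $n$-ary relation symbol $R$ and $|f(\vec s)\approx f(\vec t)|_T=0$ for each $n$-ary function symbol $f$. Then $T$ has a model $M$ whose universe is the set $C$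 of constants of $L$, in which every constant denotes itself, $T\vdash f(\vec a)\approx f^M(\vec a)$ for every function symbol $f$ and all $\vec a$ in $C$, $\approx$ is interpreted by the pseudo-metric $\rho(a,b)=|a\approx b|_T$, and $\|\varphi\|_M=|\varphi|_T$ for every sentence $\varphi$. $M$ is decidable with respect to the given numbering of the constants. -/

import Mathlib

open scoped Topology

/-! First-order rational Pavelka logic, in the convention where `0` is full truth and `1` is full
falsity, with similarity (fuzzy equality), provability degrees, standard structures and their
effective presentations. -/

namespace RPL

/-- A countable first-order language: each kind of symbol forms a set of natural numbers. Every
language has, in addition, the binary similarity symbol, and the variables are indexed by `ℕ`. -/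
structure Lang where
  IsConst : ℕ → Prop
  IsFunc : ℕ → Prop
  IsRel : ℕ → Prop
  funcArity : ℕ → ℕ
  relArity : ℕ → ℕ
  funcArity_pos : ∀ f, IsFunc f → 0 < funcArity f

namespace Lang

/-- Constants. -/
def Const (L : Lang) : Type := {n : ℕ // L.IsConst n}

/-- Function symbols (of positive arity). -/
def Func (L : Lang) : Type := {n : ℕ // L.IsFunc n}

/-- Relation symbols. -/
def Rel (L : Lang) : Type := {n : ℕ // L.IsRel n}

/-- The language is computably given: its sets of symbols are decidable and the arities are
computable. -/
structure ComputablyGiven (L : Lang) : Prop where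
  const : ComputablePred L.IsConst
  func : ComputablePred L.IsFunc
  rel : ComputablePred L.IsRel
  funcArity : Computable L.funcArity
  relArity : Computable L.relArity

end Lang

/-- Rational numbers in `[0,1]`. -/
abbrev UnitRat : Type := Set.Icc (0 : ℚ) 1

namespace UnitRat

/-- Truncated subtraction `s ∸ r = max (s - r) 0`. -/
def tsub (s r : UnitRat) : UnitRat :=
  ⟨max (s.1 - r.1) 0, le_max_right _ _,
    max_le (by have h1 := s.2.2; have h2 := r.2.1; linarith) zero_le_one⟩

/-- Code of a rational number, through its reduced fraction. -/
def code (r : UnitRat) : ℕ := Nat.pair r.1.num.natAbs r.1.den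

end UnitRat

/-- Terms. -/
inductive Term (L : Lang) : Type
  | var (x : ℕ) : Term L
  | const (c : L.Const) : Term L
  | func (f : L.Func) (args : Fin (L.funcArity f.1) → Term L) : Term L

namespace Term

variable {L : Lang}

/-- The variable `x` occurs in the term. -/
def Occurs (x : ℕ) : Term L → Prop
  | var y => y = x
  | const _ => False
  | func _ a => ∃ i, (a i).Occurs x

/-- `subst x t s` is `s[t/x]`. -/
def subst (x : ℕ) (t : Term L) : Term L → Term L
  | var y => if y = x then t else var y
  | const c => const c
  | func f a => func f fun i => subst x t (a i)

/-- Gödel number of a term. -/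
def code : Term L → ℕ
  | var y => Nat.pair 0 y
  | const c => Nat.pair 1 c.1
  | func f a => Nat.pair 2 (Nat.pair f.1 (Encodable.encode (List.ofFn fun i => (a i).code)))

end Term

/-- Closed terms. -/
def ClosedTerm (L : Lang) : Type := {t : Term L // ∀ x, ¬ t.Occurs x}

/-- Formulas: rational truth constants, similarity, relations, implication and `∀`. -/
inductive Formula (L : Lang) : Type
  | rat (r : UnitRat) : Formula L
  | sim (s t : Term L) : Formula L
  | rel (R : L.Rel) (args : Fin (L.relArity R.1) → Term L) : Formula L
  | imp (φ ψ : Formula L) : Formula L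
  | all (x : ℕ) (φ : Formula L) : Formula L

namespace Formula

variable {L : Lang}

/-- `⊥` is the truth constant of the value `1`, absolute falsity. -/
def bot : Formula L := rat ⟨1, zero_le_one, le_rfl⟩

/-- `¬φ := φ → ⊥`. -/
def neg (φ : Formula L) : Formula L := imp φ bot

/-- `φ ⊕ ψ := ¬(φ → ¬ψ)`, with truth function `min (x + y) 1`. -/
def oplus (φ ψ : Formula L) : Formula L := neg (imp φ (neg ψ))

/-- `φ ↔ ψ := (φ → ψ) ⊕ (ψ → φ)`. -/
def iff (φ ψ : Formula L) : Formula L := oplus (imp φ ψ) (imp ψ φ)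

/-- `∃x φ := ¬∀x ¬φ`. -/
def ex (x : ℕ) (φ : Formula L) : Formula L := neg (all x (neg φ))

/-- The variable `x` is free in the formula. -/
def Free (x : ℕ) : Formula L → Prop
  | rat _ => False
  | sim s t => s.Occurs x ∨ t.Occurs x
  | rel _ a => ∃ i, (a i).Occurs x
  | imp φ ψ => φ.Free x ∨ ψ.Free x
  | all y φ => y ≠ x ∧ φ.Free x

/-- A sentence is a formula without free variables. -/
def IsSentence (φ : Formula L) : Prop := ∀ x, ¬ φ.Free x

/-- `φ.subst x t` replaces the free occurrences of `x` in `φ` by `t`. -/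
def subst (x : ℕ) (t : Term L) : Formula L → Formula L
  | rat r => rat r
  | sim s s' => sim (Term.subst x t s) (Term.subst x t s')
  | rel R a => rel R fun i => Term.subst x t (a i)
  | imp φ ψ => imp (φ.subst x t) (ψ.subst x t)
  | all y φ => if y = x then all y φ else all y (φ.subst x t)

/-- No variable of `t` becomes bound when `t` is substituted for `x`. -/
def FreeFor (t : Term L) (x : ℕ) : Formula L → Prop
  | rat _ => True
  | sim _ _ => True
  | rel _ _ => True
  | imp φ ψ => φ.FreeFor t x ∧ ψ.FreeFor t x
  | all y φ => ¬ (y ≠ x ∧ φ.Free x) ∨ (¬ t.Occurs y ∧ φ.FreeFor t x)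

/-- Gödel number of a formula. -/
def code : Formula L → ℕ
  | rat r => Nat.pair 0 r.code
  | sim s t => Nat.pair 1 (Nat.pair s.code t.code)
  | rel R a => Nat.pair 2 (Nat.pair R.1 (Encodable.encode (List.ofFn fun i => (a i).code)))
  | imp φ ψ => Nat.pair 3 (Nat.pair φ.code ψ.code)
  | all y φ => Nat.pair 4 (Nat.pair y φ.code)

end Formula

open Formula in
/-- `Provable T φ`: there is a proof of `φ` from `T` in first-order rational Pavelka logic. -/
inductive Provable {L : Lang} (T : Set (Formula L)) : Formula L → Prop
  | ax {φ} : φ ∈ T → Provable T φ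
  | l1 (φ ψ) : Provable T (imp φ (imp ψ φ))
  | l2 (φ ψ σ) : Provable T (imp (imp φ ψ) (imp (imp ψ σ) (imp φ σ)))
  | l3 (φ ψ) : Provable T (imp (imp (imp φ ψ) ψ) (imp (imp ψ φ) φ))
  | l4 (φ ψ) : Provable T (imp (imp (imp φ bot) (imp ψ bot)) (imp ψ φ))
  | all1 (x φ t) : FreeFor t x φ → Provable T (imp (all x φ) (φ.subst x t))
  | all2 (x φ ψ) : ¬ φ.Free x → Provable T (imp (all x (imp φ ψ)) (imp φ (all x ψ)))
  | book (r s : UnitRat) : Provable T (iff (imp (rat r) (rat s)) (rat (s.tsub r)))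
  | refl (x : ℕ) : Provable T (sim (Term.var x) (Term.var x))
  | symm (x y : ℕ) :
      Provable T (imp (sim (Term.var x) (Term.var y)) (sim (Term.var y) (Term.var x)))
  | trans (x y z : ℕ) :
      Provable T (imp (oplus (sim (Term.var x) (Term.var y)) (sim (Term.var y) (Term.var z)))
        (sim (Term.var x) (Term.var z)))
  | mp {φ ψ} : Provable T φ → Provable T (imp φ ψ) → Provable T ψ
  | gen (x) {φ} : Provable T φ → Provable T (all x φ)

section Theories

variable {L : Lang} (T : Set (Formula L))

/-- The provability degree: the infimum of the rationals `r` in `[0,1]` such that `T` proves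
`r → φ`. -/
noncomputable def provDeg (φ : Formula L) : ℝ :=
  sInf {x : ℝ | ∃ r : UnitRat, x = ((r.1 : ℚ) : ℝ) ∧ Provable T (Formula.imp (Formula.rat r) φ)}

def Consistent : Prop := ¬ Provable T Formula.bot

def LinearComplete : Prop :=
  ∀ φ ψ : Formula L, φ.IsSentence → ψ.IsSentence →
    Provable T (Formula.imp φ ψ) ∨ Provable T (Formula.imp ψ φ)

def IsHenkin : Prop :=
  ∀ (x : ℕ) (φ : Formula L), (Formula.ex x φ).IsSentence → Provable T (Formula.ex x φ) →
    ∃ c : L.Const, Provable T (φ.subst x (Term.const c))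

/-- The set of axioms is computably enumerable. -/
def ComputablyAxiomatizable : Prop :=
  REPred fun n : ℕ => ∃ φ ∈ T, φ.code = n

/-- Closed terms at distance `0` are not distinguished by relation and function symbols. -/
def Congruential : Prop :=
  (∀ (R : L.Rel) (s t : Fin (L.relArity R.1) → Term L),
    (∀ i x, ¬ (s i).Occurs x) → (∀ i x, ¬ (t i).Occurs x) →
    (∀ i, provDeg T (Formula.sim (s i) (t i)) = 0) →
      provDeg T (Formula.rel R s) = provDeg T (Formula.rel R t)) ∧
  (∀ (f : L.Func) (s t : Fin (L.funcArity f.1) → Term L),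
    (∀ i x, ¬ (s i).Occurs x) → (∀ i x, ¬ (t i).Occurs x) →
    (∀ i, provDeg T (Formula.sim (s i) (t i)) = 0) →
      provDeg T (Formula.sim (Term.func f s) (Term.func f t)) = 0)

end Theories

/-- A standard structure with universe `M`: similarity and relations take values in `[0,1]`. -/
structure Struc (L : Lang) (M : Type) where
  nonempty : Nonempty M
  const : L.Const → M
  func : (f : L.Func) → (Fin (L.funcArity f.1) → M) → M
  sim : M → M → unitInterval
  rel : (R : L.Rel) → (Fin (L.relArity R.1) → M) → unitInterval

namespace Struc

variable {L : Lang} {M : Type} (S : Struc L M)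

/-- Value of a term under an evaluation. -/
def termVal (v : ℕ → M) : Term L → M
  | Term.var x => v x
  | Term.const c => S.const c
  | Term.func f a => S.func f fun i => termVal v (a i)

/-- Truth degree of a formula under an evaluation. -/
noncomputable def eval : Formula L → (ℕ → M) → ℝ
  | Formula.rat r, _ => ((r.1 : ℚ) : ℝ)
  | Formula.sim s t, v => (S.sim (S.termVal v s) (S.termVal v t) : ℝ)
  | Formula.rel R a, v => (S.rel R fun i => S.termVal v (a i) : ℝ)
  | Formula.imp φ ψ, v => max (eval ψ v - eval φ v) 0
  | Formula.all x φ, v => ⨆ a : M, eval φ (Function.update v x a)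

/-- Truth degree of a formula in the structure: the supremum over all evaluations. -/
noncomputable def degree (φ : Formula L) : ℝ := ⨆ v : ℕ → M, S.eval φ v

/-- The structure is a model of `T`: all members of `T` have degree `0` under all evaluations. -/
def Models (T : Set (Formula L)) : Prop := ∀ φ ∈ T, ∀ v, S.eval φ v = 0

/-- The interpretation of similarity is a pseudo-metric. -/
def SimPseudoMetric : Prop :=
  (∀ a, (S.sim a a : ℝ) = 0) ∧ (∀ a b, (S.sim a b : ℝ) = S.sim b a) ∧
    ∀ a b c, (S.sim a c : ℝ) ≤ S.sim a b + S.sim b c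

end Struc

/-- The rational interval `[p,q]` approximates the point `x` in the domain of closed subintervals of
`[0,1]`: the point lies in the interior of `[p,q]` relative to `[0,1]`. -/
def Approximates (p q : UnitRat) (x : ℝ) : Prop :=
  Set.Icc ((p.1 : ℚ) : ℝ) ((q.1 : ℚ) : ℝ) ∈ 𝓝[Set.Icc (0 : ℝ) 1] x

/-- The structure is decidable when its elements are numbered by `ν`: the universe is a decidable
set, the constants and functions are computable, and the elementary diagram is computably
enumerable. A sentence with parameters from the universe is a formula together with the list of
the parameters assigned to the variables `0, …, n - 1`, among which are its free variables. The
diagram holds the pairs of such a sentence and a rational interval approximating its degree. -/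
structure Struc.DecidableVia {L : Lang} {M : Type} (S : Struc L M) (ν : M → ℕ) : Prop where
  injective : Function.Injective ν
  universe_decidable : ComputablePred fun n => ∃ a, ν a = n
  const : ∃ g : ℕ → ℕ, Computable g ∧ ∀ c : L.Const, g c.1 = ν (S.const c)
  func : ∃ g : ℕ × List ℕ → ℕ, Computable g ∧
    ∀ (f : L.Func) (a : Fin (L.funcArity f.1) → M),
      g (f.1, List.ofFn fun i => ν (a i)) = ν (S.func f a)
  diagram : REPred fun w : ℕ × List ℕ × ℕ × ℕ =>
    ∃ (φ : Formula L) (n : ℕ) (v : ℕ → M) (p q : UnitRat),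
      (∀ x, φ.Free x → x < n) ∧
      w = (φ.code, (List.range n).map (fun i => ν (v i)), p.code, q.code) ∧
      Approximates p q (S.eval φ v)

end RPL

-- The provability degree itself is a truth valuation on sentences. By linear completeness every
-- sentence `φ` is comparable with every truth constant: if `r < |φ|`, then `r̄ → φ` is not
-- provable, so `φ → r̄` is. Hence `|φ|` is approximated by provable implications from both sides,
-- and the bookkeeping axioms turn this into `|φ → ψ| = max (|ψ| - |φ|) 0` (`provDeg_imp`).
-- Consistency makes distinct constants keep distinct degrees (`Provable.rat_eq_zero`). For
-- quantifiers, if `r < |∀x φ|`, then `∀x φ → r̄` is provable, hence so is `∃x (φ → r̄)`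
-- (`Provable.ex_imp`). A Henkin constant `c` for it gives `|φ[c/x]| ≥ r`, so `∀` is the supremum of
-- its instances (`exists_const_le_provDeg`). A structure whose elements are named by closed terms,
-- including all constants, and whose atomic degrees are provability degrees therefore satisfies the
-- truth lemma `Struc.Named.eval_eq`. The closed terms form such a structure at once. For the
-- constants, the Henkin property applied to `∃x (t ≈ x)` makes every closed term provably similar
-- to a constant; congruence guarantees that replacing a term by such a constant does not change
-- atomic degrees (`constStruc_named`). Decidability rests on the enumerability of theorems
-- (`rePred_provable`): `|φ| > p` means that `φ → r̄` is provable for some `r > p`, and `|φ| < q`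
-- that `r̄ → φ` is provable for some `r < q`. Both are computably enumerable, and so is the
-- diagram, since putting names for parameters is computable on Gödel numbers. The functions on
-- constants are found by searching through the theorems (`exists_computable_func`).

attribute [fun_prop] Computable

/-! ### Computability: closure rules for `fun_prop` and course-of-values recursion. -/

namespace Computable

variable {α β γ σ : Type*} [Primcodable α] [Primcodable β] [Primcodable γ] [Primcodable σ]

@[fun_prop] theorem comp_id : Computable (fun a : α => a) := Computable.id

@[fun_prop] theorem comp_const (s : σ) : Computable (fun _ : α => s) := Computable.const s

@[fun_prop] theorem comp_comp {f : β → σ} {g : α → β} (hf : Computable f) (hg : Computable g) :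
    Computable (fun a => f (g a)) := hf.comp hg

@[fun_prop] theorem comp_mk {f : α → β} {g : α → γ} (hf : Computable f) (hg : Computable g) :
    Computable (fun a => (f a, g a)) := hf.pair hg

@[fun_prop] theorem comp_fst {f : α → β × γ} (hf : Computable f) : Computable (fun a => (f a).1) :=
  Computable.fst.comp hf

@[fun_prop] theorem comp_snd {f : α → β × γ} (hf : Computable f) : Computable (fun a => (f a).2) :=
  Computable.snd.comp hf

@[fun_prop] theorem comp_natPair {f g : α → ℕ} (hf : Computable f) (hg : Computable g) :
    Computable (fun a => Nat.pair (f a) (g a)) :=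
  Primrec₂.natPair.to_comp.comp hf hg

@[fun_prop] theorem comp_unpair {f : α → ℕ} (hf : Computable f) :
    Computable (fun a => (f a).unpair) := Computable.unpair.comp hf

@[fun_prop] theorem comp_cond {c : α → Bool} {f g : α → σ} (hc : Computable c) (hf : Computable f)
    (hg : Computable g) : Computable (fun a => bif c a then f a else g a) := hc.cond hf hg

@[fun_prop] theorem comp_bind {f : α → Option β} {g : α → β → Option σ} (hf : Computable f)
    (hg : Computable fun p : α × β => g p.1 p.2) : Computable fun a => (f a).bind (g a) :=
  hf.option_bind hg

@[fun_prop] theorem comp_optionMap {f : α → Option β} {g : α → β → σ} (hf : Computable f)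
    (hg : Computable fun p : α × β => g p.1 p.2) : Computable fun a => (f a).map (g a) :=
  hf.option_map hg

@[fun_prop] theorem comp_elim {f : α → Option β} {d : α → σ} {g : α → β → σ} (hf : Computable f)
    (hd : Computable d) (hg : Computable fun p : α × β => g p.1 p.2) :
    Computable fun a => (f a).elim (d a) (g a) :=
  (Computable.option_casesOn hf hd hg).of_eq fun a => by cases f a <;> rfl

@[fun_prop] theorem comp_some {f : α → β} (hf : Computable f) : Computable (fun a => some (f a)) :=
  Computable.option_some.comp hf

@[fun_prop] theorem comp_isSome {f : α → Option β} (hf : Computable f) :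
    Computable (fun a => (f a).isSome) := Primrec.option_isSome.to_comp.comp hf

@[fun_prop] theorem comp_getD {f : α → Option β} {d : α → β} (hf : Computable f)
    (hd : Computable d) : Computable (fun a => (f a).getD (d a)) := hf.option_getD hd

@[fun_prop] theorem comp_and {f g : α → Bool} (hf : Computable f) (hg : Computable g) :
    Computable (fun a => f a && g a) := Primrec.and.to_comp.comp hf hg

@[fun_prop] theorem comp_or {f g : α → Bool} (hf : Computable f) (hg : Computable g) :
    Computable (fun a => f a || g a) := Primrec.or.to_comp.comp hf hg

@[fun_prop] theorem comp_not {f : α → Bool} (hf : Computable f) :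
    Computable (fun a => !f a) := Primrec.not.to_comp.comp hf

@[fun_prop] theorem comp_beq [BEq β] [LawfulBEq β] {f g : α → β} (hf : Computable f)
    (hg : Computable g) : Computable (fun a => f a == g a) := by
  classical
  exact (Primrec.eq.decide.to_comp.comp hf hg).of_eq fun a => by rw [Bool.eq_iff_iff]; simp

@[fun_prop] theorem comp_ble {f g : α → ℕ} (hf : Computable f) (hg : Computable g) :
    Computable (fun a => (f a).ble (g a)) :=
  (Primrec.nat_le.decide.to_comp.comp hf hg).of_eq fun a => by rw [Bool.eq_iff_iff]; simp

@[fun_prop] theorem comp_add {f g : α → ℕ} (hf : Computable f) (hg : Computable g) :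
    Computable (fun a => f a + g a) := Primrec.nat_add.to_comp.comp hf hg

@[fun_prop] theorem comp_sub {f g : α → ℕ} (hf : Computable f) (hg : Computable g) :
    Computable (fun a => f a - g a) := Primrec.nat_sub.to_comp.comp hf hg

@[fun_prop] theorem comp_mul {f g : α → ℕ} (hf : Computable f) (hg : Computable g) :
    Computable (fun a => f a * g a) := Primrec.nat_mul.to_comp.comp hf hg

@[fun_prop] theorem comp_encode {f : α → β} (hf : Computable f) :
    Computable (fun a => Encodable.encode (f a)) := Computable.encode.comp hf

@[fun_prop] theorem comp_decode {f : α → ℕ} (hf : Computable f) :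
    Computable (fun a => (Encodable.decode (f a) : Option β)) := Computable.decode.comp hf

@[fun_prop] theorem comp_ofNat_list {f : α → ℕ} (hf : Computable f) :
    Computable (fun a => Denumerable.ofNat (List ℕ) (f a)) :=
  Computable.option_some_iff.1 <| (Computable.decode.comp hf).of_eq fun a => by
    rw [Denumerable.decode_eq_ofNat]

@[fun_prop] theorem comp_cons {f : α → β} {g : α → List β} (hf : Computable f)
    (hg : Computable g) : Computable (fun a => f a :: g a) := Computable.list_cons.comp hf hg

@[fun_prop] theorem comp_append {f g : α → List β} (hf : Computable f)
    (hg : Computable g) : Computable (fun a => f a ++ g a) := Computable.list_append.comp hf hg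

@[fun_prop] theorem comp_length {f : α → List β} (hf : Computable f) :
    Computable (fun a => (f a).length) := Computable.list_length.comp hf

@[fun_prop] theorem comp_getElem? {f : α → List β} {g : α → ℕ} (hf : Computable f)
    (hg : Computable g) : Computable (fun a => (f a)[g a]?) := Computable.list_getElem?.comp hf hg

@[fun_prop] theorem comp_natRec {f : α → ℕ} {g : α → σ} {h : α → ℕ → σ → σ} (hf : Computable f)
    (hg : Computable g) (hh : Computable fun p : α × ℕ × σ => h p.1 p.2.1 p.2.2) :
    Computable fun a => Nat.rec (motive := fun _ => σ) (g a) (h a) (f a) :=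
  Computable.nat_rec (h := fun a p => h a p.1 p.2) hf hg hh

-- A fold is a primitive recursion on the position in the list: after `n` steps the state is the
-- fold of the first `n` entries. The other list operations below reduce to this one.
@[fun_prop] theorem comp_foldl {f : α → List β} {g : α → σ} {h : α → σ → β → σ}
    (hf : Computable f) (hg : Computable g)
    (hh : Computable fun p : α × σ × β => h p.1 p.2.1 p.2.2) :
    Computable fun a => (f a).foldl (h a) (g a) := by
  have key : Computable fun a => Nat.rec (motive := fun _ => σ) (g a)
      (fun i s => ((f a)[i]?).elim s (h a s)) (f a).length := by
    have h1 : Computable fun p : α × ℕ × σ => ((f p.1)[p.2.1]?).elim p.2.2 (h p.1 p.2.2) := by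
      have h2 : Computable fun p : (α × ℕ × σ) × β => h p.1.1 p.1.2.2 p.2 :=
        hh.comp (g := fun p : (α × ℕ × σ) × β => (p.1.1, p.1.2.2, p.2)) (by fun_prop)
      fun_prop
    fun_prop
  refine key.of_eq fun a => ?_
  have : ∀ n ≤ (f a).length, Nat.rec (motive := fun _ => σ) (g a)
      (fun i s => ((f a)[i]?).elim s (h a s)) n = ((f a).take n).foldl (h a) (g a) := by
    intro n
    induction n with
    | zero => simp
    | succ n ih =>
      intro hn
      simp only [ih (by omega), List.take_add_one, List.foldl_append]
      rw [List.getElem?_eq_getElem (by omega)]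
      simp
  simpa using this _ le_rfl

@[fun_prop] theorem comp_flatMap {f : α → List β} {g : α → β → List σ} (hf : Computable f)
    (hg : Computable fun p : α × β => g p.1 p.2) : Computable fun a => (f a).flatMap (g a) := by
  have h2 : Computable fun p : α × List σ × β => g p.1 p.2.2 :=
    hg.comp (g := fun p : α × List σ × β => (p.1, p.2.2)) (by fun_prop)
  have : Computable fun a => (f a).foldl (fun s b => s ++ g a b) [] := by fun_prop
  refine this.of_eq fun a => ?_
  have : ∀ (l : List β) (s : List σ), l.foldl (fun s b => s ++ g a b) s = s ++ l.flatMap (g a) := by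
    intro l
    induction l with
    | nil => simp
    | cons b l ih => intro s; simp [ih]
  simpa using this (f a) []

@[fun_prop] theorem comp_map {f : α → List β} {g : α → β → σ} (hf : Computable f)
    (hg : Computable fun p : α × β => g p.1 p.2) : Computable fun a => (f a).map (g a) := by
  have : Computable fun a => (f a).flatMap (fun b => [g a b]) := by fun_prop
  exact this.of_eq fun a => List.map_eq_flatMap.symm

@[fun_prop] theorem comp_filterMap {f : α → List β} {g : α → β → Option σ} (hf : Computable f)
    (hg : Computable fun p : α × β => g p.1 p.2) : Computable fun a => (f a).filterMap (g a) := by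
  have : Computable fun a => (f a).flatMap (fun b => (g a b).elim [] fun c => [c]) := by fun_prop
  refine this.of_eq fun a => ?_
  induction f a with
  | nil => rfl
  | cons b l ih => cases h : g a b <;> simp [h, ih]

@[fun_prop] theorem comp_filter {f : α → List β} {g : α → β → Bool} (hf : Computable f)
    (hg : Computable fun p : α × β => g p.1 p.2) : Computable fun a => (f a).filter (g a) := by
  have : Computable fun a => (f a).flatMap (fun b => bif g a b then [b] else []) := by fun_prop
  refine this.of_eq fun a => ?_
  induction f a with
  | nil => rfl
  | cons b l ih => cases h : g a b <;> simp [h, ih]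

@[fun_prop] theorem comp_all {f : α → List β} {g : α → β → Bool} (hf : Computable f)
    (hg : Computable fun p : α × β => g p.1 p.2) : Computable fun a => (f a).all (g a) := by
  have : Computable fun a => ((f a).filter (fun b => !g a b)).length == 0 := by fun_prop
  refine this.of_eq fun a => ?_
  rw [Bool.eq_iff_iff]
  simp

@[fun_prop] theorem comp_any {f : α → List β} {g : α → β → Bool} (hf : Computable f)
    (hg : Computable fun p : α × β => g p.1 p.2) : Computable fun a => (f a).any (g a) := by
  have : Computable fun a => !(f a).all (fun b => !g a b) := by fun_prop
  exact this.of_eq fun a => by simp [List.all_eq_not_any_not]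

@[fun_prop] theorem comp_elem {f : α → ℕ} {g : α → List ℕ}
    (hf : Computable f) (hg : Computable g) : Computable (fun a => (g a).elem (f a)) := by
  have : Computable fun a => (g a).any fun b => b == f a := by fun_prop
  refine this.of_eq fun a => ?_
  rw [Bool.eq_iff_iff]
  simp

/-- A bounded search for common divisors suffices, since the gcd is at most the sum. The divisor `0`
matters only for the pair `(0, 0)`, because `n % 0 = n`. -/
theorem decide_coprime : Computable fun p : ℕ × ℕ => decide (Nat.Coprime p.1 p.2) := by
  have h : PrimrecPred fun p : ℕ × ℕ => ∀ d < p.1 + p.2 + 2, d = 1 ∨ ¬ (p.1 % d = 0 ∧ p.2 % d = 0) := by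
    have hR : PrimrecRel fun (d : ℕ) (p : ℕ × ℕ) => d = 1 ∨ ¬ (p.1 % d = 0 ∧ p.2 % d = 0) := by
      refine PrimrecPred.or ?_ (PrimrecPred.not (PrimrecPred.and ?_ ?_))
      · exact Primrec.eq.comp Primrec.fst (Primrec.const 1)
      · exact Primrec.eq.comp (Primrec.nat_mod.comp (Primrec.fst.comp Primrec.snd) Primrec.fst)
          (Primrec.const 0)
      · exact Primrec.eq.comp (Primrec.nat_mod.comp (Primrec.snd.comp Primrec.snd) Primrec.fst)
          (Primrec.const 0)
    have h2 := PrimrecRel.comp (f := fun p : ℕ × ℕ => List.range (p.1 + p.2 + 2))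
      (g := fun p : ℕ × ℕ => p) (PrimrecRel.forall_mem_list hR)
      (Primrec.list_range.comp <| Primrec.succ.comp <|
      Primrec.succ.comp <| Primrec.nat_add.comp Primrec.fst Primrec.snd) Primrec.id
    exact h2.of_eq fun p => by simp only [List.mem_range]
  refine h.decide.to_comp.of_eq fun p => ?_
  congr 1
  rw [eq_iff_iff]
  constructor
  · intro h
    rcases Nat.eq_zero_or_pos (p.1 + p.2) with h0 | h0
    · have := h 0 (by omega)
      simp at this; omega
    · have hle : Nat.gcd p.1 p.2 ≤ p.1 + p.2 := by
        rcases Nat.eq_zero_or_pos p.1 with h1 | h1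
        · simp [h1]
        · exact (Nat.gcd_le_left _ h1).trans (by omega)
      rcases h (Nat.gcd p.1 p.2) (by omega) with h2 | h2
      · exact h2
      · exact absurd ⟨Nat.mod_eq_zero_of_dvd (Nat.gcd_dvd_left _ _),
          Nat.mod_eq_zero_of_dvd (Nat.gcd_dvd_right _ _)⟩ h2
  · intro h d _
    by_contra hd
    push Not at hd
    exact hd.1 (Nat.eq_one_of_dvd_coprimes h (Nat.dvd_of_mod_eq_zero hd.2.1)
      (Nat.dvd_of_mod_eq_zero hd.2.2))

/-- A function defined by course-of-values recursion with a computable step is computable. -/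
theorem of_strong_rec {f : α → ℕ → σ} (g : α → List σ → σ)
    (hg : Computable fun p : α × List σ => g p.1 p.2)
    (H : ∀ a n, f a n = g a ((List.range n).map (f a))) :
    Computable fun p : α × ℕ => f p.1 p.2 :=
  Computable.nat_strong_rec f (g := fun a l => some (g a l)) (Computable.option_some.comp hg)
    fun a n => by rw [← H]

end Computable

/-- Course-of-values recursion. -/
theorem exists_strong_rec {σ : Type*} (g : List σ → σ) :
    ∃ f : ℕ → σ, ∀ n, f n = g ((List.range n).map f) := by
  have key : ∀ n, ∃ l : List σ, l.length = n ∧ ∀ i (h : i < l.length), l[i] = g (l.take i) := by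
    intro n
    induction n with
    | zero => exact ⟨[], rfl, fun i h => by simp at h⟩
    | succ n ih =>
      obtain ⟨l, hl, h⟩ := ih
      refine ⟨l ++ [g l], by simp [hl], fun i hi => ?_⟩
      simp only [List.length_append, List.length_cons, List.length_nil] at hi
      rcases Nat.lt_or_ge i l.length with h1 | h1
      · rw [List.getElem_append_left h1, h i h1, List.take_append_of_le_length h1.le]
      · have : i = l.length := by omega
        subst this
        simp
  choose l hl h using key
  -- The lists for different lengths are chosen independently; the recursion forces their common
  -- entries to agree.
  have agree : ∀ i m n, i < m → i < n → (l m)[i]? = (l n)[i]? := by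
    intro i
    induction i using Nat.strong_induction_on with
    | _ i ih =>
      intro m n hm hn
      rw [List.getElem?_eq_getElem (by rw [hl]; exact hm),
        List.getElem?_eq_getElem (by rw [hl]; exact hn), h, h]
      congr 2
      apply List.ext_getElem?
      intro j
      rw [List.getElem?_take, List.getElem?_take]
      split_ifs with hj
      · exact ih j hj m n (by omega) (by omega)
      · rfl
  refine ⟨fun n => (l (n + 1))[n]'(by rw [hl]; omega), fun n => ?_⟩
  simp only
  rw [h]
  congr 1
  apply List.ext_getElem?
  intro j
  rw [List.getElem?_take, List.getElem?_map]
  by_cases hj : j < n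
  · have h2 := agree j (n + 1) (j + 1) (by omega) (by omega)
    rw [if_pos hj, h2, List.getElem?_eq_getElem (by rw [hl]; omega),
      List.getElem?_eq_getElem (by simpa using hj)]
    simp
  · rw [if_neg hj, List.getElem?_eq_none (by simpa using hj)]
    rfl

/-! ### Computably enumerable predicates. -/

namespace REPred

variable {α β : Type*} [Primcodable α] [Primcodable β]

/-- The witness `k` bounds the running time of a program that semidecides `p`; conversely, unbounded
search for `k` semidecides `p`. -/
theorem iff_exists_computable {p : α → Prop} :
    REPred p ↔ ∃ q : α × ℕ → Bool, Computable q ∧ ∀ a, p a ↔ ∃ k, q (a, k) = true := by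
  constructor
  · intro h
    obtain ⟨c, hc⟩ := Nat.Partrec.Code.exists_code.1 h
    refine ⟨fun x => (Nat.Partrec.Code.evaln x.2 c (Encodable.encode x.1)).isSome, ?_, fun a => ?_⟩
    · have h1 := Nat.Partrec.Code.primrec_evaln.to_comp
      have h2 : Computable fun x : α × ℕ => ((x.2, c), Encodable.encode x.1) := by fun_prop
      exact Primrec.option_isSome.to_comp.comp (h1.comp h2)
    · have : p a ↔ (Nat.Partrec.Code.eval c (Encodable.encode a)).Dom := by
        rw [hc]; simp [Part.dom_iff_mem]
      rw [this, Part.dom_iff_mem]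
      simp only [Nat.Partrec.Code.evaln_complete, Option.isSome_iff_exists]
      rw [exists_comm]
      rfl
  · rintro ⟨q, hq, h⟩
    have h1 : Partrec fun a : α => Nat.rfind ((fun k => q (a, k) : ℕ → Bool) : ℕ →. Bool) :=
      Partrec.rfind (Computable.partrec (f := fun x : α × ℕ => q (x.1, x.2)) (by simpa using hq))
    refine h1.dom_re.of_eq fun a => ?_
    rw [h]
    refine Nat.rfind_dom'.trans ?_
    simp

theorem of_computable {q : α → Bool} (hq : Computable q) : REPred fun a => q a = true :=
  iff_exists_computable.2 ⟨fun x => q x.1, by fun_prop, fun a => by simp⟩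

protected theorem comp {p : β → Prop} (hp : REPred p) {f : α → β} (hf : Computable f) :
    REPred fun a => p (f a) := by
  obtain ⟨q, hq, h⟩ := iff_exists_computable.1 hp
  exact iff_exists_computable.2 ⟨fun x => q (f x.1, x.2), by fun_prop, fun a => h _⟩

protected theorem proj {p : α → β → Prop} (hp : REPred fun x : α × β => p x.1 x.2) :
    REPred fun a => ∃ b, p a b := by
  obtain ⟨q, hq, h⟩ := iff_exists_computable.1 hp
  -- One number codes both the witness `b` and the witness for the decidable matrix at `b`.
  refine iff_exists_computable.2 ⟨fun x => ((Encodable.decode x.2.unpair.1 : Option β)).elim false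
    (fun b => q ((x.1, b), x.2.unpair.2)), by fun_prop, fun a => ?_⟩
  constructor
  · rintro ⟨b, hb⟩
    obtain ⟨k, hk⟩ := (h (a, b)).1 hb
    exact ⟨Nat.pair (Encodable.encode b) k, by simpa using hk⟩
  · rintro ⟨k, hk⟩
    simp only at hk
    cases hd : (Encodable.decode k.unpair.1 : Option β) with
    | none => simp [hd] at hk
    | some b => exact ⟨b, (h (a, b)).2 ⟨k.unpair.2, by simpa [hd] using hk⟩⟩

protected theorem and {p p' : α → Prop} (hp : REPred p) (hp' : REPred p') :
    REPred fun a => p a ∧ p' a := by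
  obtain ⟨q, hq, h⟩ := iff_exists_computable.1 hp
  obtain ⟨q', hq', h'⟩ := iff_exists_computable.1 hp'
  have : REPred fun x : α × (ℕ × ℕ) => (q (x.1, x.2.1) && q' (x.1, x.2.2)) = true :=
    of_computable (by fun_prop)
  refine (REPred.proj (p := fun a (k : ℕ × ℕ) => (q (a, k.1) && q' (a, k.2)) = true)
    this).of_eq fun a => ?_
  rw [h, h']
  simp

protected theorem or {p p' : α → Prop} (hp : REPred p) (hp' : REPred p') :
    REPred fun a => p a ∨ p' a := by
  obtain ⟨q, hq, h⟩ := iff_exists_computable.1 hp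
  obtain ⟨q', hq', h'⟩ := iff_exists_computable.1 hp'
  refine iff_exists_computable.2 ⟨fun x => q x || q' x, by fun_prop, fun a => ?_⟩
  rw [h, h']
  simp [exists_or]

/-- The range of a computable partial function is computably enumerable. -/
theorem range_option [DecidableEq α] {f : β → Option α} (hf : Computable f) :
    REPred fun a => ∃ b, f b = some a := by
  have : REPred fun x : α × β => (f x.2 == some x.1) = true :=
    of_computable (by fun_prop)
  exact (REPred.proj (p := fun a b => (f b == some a) = true) this).of_eq
    fun a => by simp

/-- A computably enumerable set is the range of a computable partial function. -/
theorem exists_enumeration {p : α → Prop} (hp : REPred p) :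
    ∃ e : ℕ → Option α, Computable e ∧ ∀ a, p a ↔ ∃ k, e k = some a := by
  obtain ⟨q, hq, h⟩ := iff_exists_computable.1 hp
  refine ⟨fun k => (Encodable.decode k.unpair.1 : Option α).bind fun a =>
    bif q (a, k.unpair.2) then some a else none, by fun_prop, fun a => ?_⟩
  rw [h]
  constructor
  · rintro ⟨k, hk⟩
    exact ⟨Nat.pair (Encodable.encode a) k, by simp [hk]⟩
  · rintro ⟨k, hk⟩
    simp only [Option.bind_eq_some_iff] at hk
    obtain ⟨b, hb, hk⟩ := hk
    cases hq' : q (b, k.unpair.2) <;> simp [hq'] at hk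
    exact ⟨_, hk ▸ hq'⟩

/-- Uniformization: a computably enumerable relation that is total on a decidable set has a
computable choice function there. -/
theorem exists_choice {r : α → ℕ → Prop} (hr : REPred fun x : α × ℕ => r x.1 x.2)
    {d : α → Bool} (hd : Computable d) (H : ∀ a, d a = true → ∃ n, r a n) :
    ∃ g : α → ℕ, Computable g ∧ ∀ a, d a = true → r a (g a) := by
  obtain ⟨q, hq, h⟩ := iff_exists_computable.1 hr
  -- Outside `d` the test succeeds trivially, which makes the search total.
  have hex : ∀ a, ∃ k : ℕ, (!d a || q ((a, k.unpair.1), k.unpair.2)) = true := by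
    intro a
    cases hda : d a with
    | false => simp
    | true =>
      obtain ⟨n, hn⟩ := H a hda
      obtain ⟨k, hk⟩ := (h (a, n)).1 hn
      exact ⟨Nat.pair n k, by simpa using hk⟩
  have hP : Computable fun x : α × ℕ => !d x.1 || q ((x.1, x.2.unpair.1), x.2.unpair.2) := by
    fun_prop
  have hf := Computable.find (P := fun a k => (!d a || q ((a, k.unpair.1), k.unpair.2)) = true)
    (Computable.computablePred (by simpa using hP)) hex
  obtain ⟨g, hg, hspec⟩ : ∃ g : α → ℕ, Computable g ∧
      ∀ a, (!d a || q ((a, (g a).unpair.1), (g a).unpair.2)) = true :=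
    ⟨_, hf, fun a => Nat.find_spec (hex a)⟩
  refine ⟨fun a => (g a).unpair.1, by fun_prop, fun a ha => ?_⟩
  have := hspec a
  simp only [Bool.or_eq_true, Bool.not_eq_true', ha, Bool.true_eq_false, false_or] at this
  exact (h (a, _)).2 ⟨_, this⟩

/-- The least predicate on `ℕ` that contains `A` and is closed under a ternary partial rule. -/
inductive Closure (A : ℕ → Prop) (R : ℕ × ℕ × ℕ → Option ℕ) : ℕ → Prop
  | base {n} : A n → Closure A R n
  | step {k a b c} : Closure A R a → Closure A R b → R (k, a, b) = some c → Closure A R c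

/-- Derivations are numbers: `Nat.pair 0 k` cites the `k`-th element of the enumeration of `A`, and
`Nat.pair (k + 1) (Nat.pair i j)` applies the rule with parameter `k` to the conclusions of the
smaller derivations `i` and `j`. The map from derivations to conclusions is a computable
course-of-values recursion with the closure as its range. -/
theorem closure {A : ℕ → Prop} {R : ℕ × ℕ × ℕ → Option ℕ} (hA : REPred A)
    (hR : Computable R) : REPred (Closure A R) := by
  obtain ⟨e, he, heA⟩ := exists_enumeration hA
  let g : List (Option ℕ) → Option ℕ := fun l =>
    bif l.length.unpair.1 == 0 then e l.length.unpair.2 else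
      (l[l.length.unpair.2.unpair.1]?).bind fun u => u.bind fun a =>
        (l[l.length.unpair.2.unpair.2]?).bind fun w => w.bind fun b =>
          R (l.length.unpair.1 - 1, a, b)
  have hg : Computable g := by
    fun_prop
  obtain ⟨f, hf⟩ := exists_strong_rec g
  have hfc : Computable f := by
    have h1 := Computable.of_strong_rec (α := Unit) (f := fun _ n => f n) (fun _ l => g l)
      (by fun_prop) (fun _ n => hf n)
    exact h1.comp (g := fun n : ℕ => ((), n)) (by fun_prop)
  refine (range_option hfc).of_eq fun n => ⟨?_, fun h => ?_⟩
  · rintro ⟨d, hd⟩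
    induction d using Nat.strong_induction_on generalizing n with
    | _ d ih =>
      rw [hf] at hd
      simp only [g, List.length_map, List.length_range] at hd
      by_cases h0 : d.unpair.1 = 0
      · exact .base ((heA n).2 ⟨_, by simpa [h0] using hd⟩)
      · simp only [beq_eq_false_iff_ne.2 h0, cond_false, Option.bind_eq_some_iff, List.getElem?_map,
          Option.map_eq_some_iff] at hd
        obtain ⟨u, ⟨i, hi, rfl⟩, a, ha, w, ⟨j, hj, rfl⟩, b, hb, hc⟩ := hd
        have hi' := List.getElem?_eq_some_iff.1 hi
        have hj' := List.getElem?_eq_some_iff.1 hj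
        simp only [List.length_range, List.getElem_range] at hi' hj'
        obtain ⟨hi1, rfl⟩ := hi'
        obtain ⟨hj1, rfl⟩ := hj'
        exact .step (ih _ hi1 a ha) (ih _ hj1 b hb) hc
  · induction h with
    | base h =>
      obtain ⟨k, hk⟩ := (heA _).1 h
      exact ⟨Nat.pair 0 k, by rw [hf]; simp [g, hk]⟩
    | @step k a b c _ _ hR ih1 ih2 =>
      obtain ⟨i, hi⟩ := ih1
      obtain ⟨j, hj⟩ := ih2
      refine ⟨Nat.pair (k + 1) (Nat.pair i j), ?_⟩
      have hlt : ∀ m, m ≤ Nat.pair i j → m < Nat.pair (k + 1) (Nat.pair i j) := by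
        intro m hm
        refine lt_of_le_of_lt hm ?_
        generalize Nat.pair i j = t
        unfold Nat.pair
        split_ifs <;> nlinarith
      rw [hf]
      simp [g, hlt i (Nat.left_le_pair i j), hlt j (Nat.right_le_pair i j), hi, hj, hR]

end REPred

/-! ### Tools for recursion on codes of lists. -/

/-- Collects the values of a partial function on a list, if all of them are defined. -/
def List.collect {σ : Type*} (g : ℕ → Option σ) (l : List ℕ) : Option (List σ) :=
  bif l.all fun m => (g m).isSome then some (l.filterMap g) else none

theorem List.collect_ofFn {σ : Type*} {g : ℕ → Option σ} {n : ℕ} {c : Fin n → ℕ} {d : Fin n → σ}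
    (h : ∀ i, g (c i) = some (d i)) : (List.ofFn c).collect g = some (List.ofFn d) := by
  have h1 : ((List.ofFn c).all fun m => (g m).isSome) = true := by
    rw [List.all_eq_true]
    intro m hm
    obtain ⟨i, rfl⟩ := List.mem_ofFn.1 hm
    simp [h]
  rw [List.collect, h1, cond_true, List.ofFn_eq_map, List.filterMap_map, List.ofFn_eq_map,
    ← List.filterMap_eq_map]
  exact congrArg some (List.filterMap_congr fun i _ => by simp [h])

theorem List.isSome_of_collect {σ : Type*} {g : ℕ → Option σ} {l : List ℕ} {rs : List σ}
    (h : l.collect g = some rs) : ∀ m ∈ l, (g m).isSome = true := by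
  unfold List.collect at h
  cases h1 : l.all fun m => (g m).isSome
  · simp [h1] at h
  · exact List.all_eq_true.1 h1

@[fun_prop] theorem Computable.comp_collect {α σ : Type*} [Primcodable α] [Primcodable σ]
    {f : α → List ℕ} {g : α → ℕ → Option σ} (hf : Computable f)
    (hg : Computable fun p : α × ℕ => g p.1 p.2) : Computable fun a => (f a).collect (g a) := by
  unfold List.collect
  fun_prop

/-- Every constructor with recursive arguments has a positive tag, so the codes of its arguments are
smaller than its own code and lie in the recursion history. -/
theorem Nat.lt_pair_of_pos {a b c : ℕ} (ha : 0 < a) (h : c ≤ b) : c < Nat.pair a b := by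
  refine lt_of_le_of_lt h ?_
  unfold Nat.pair
  split_ifs <;> nlinarith

theorem List.lt_encode_of_mem {m : ℕ} {l : List ℕ} (h : m ∈ l) : m < Encodable.encode l := by
  induction l with
  | nil => simp at h
  | cons a l ih =>
    rw [Encodable.encode_list_cons, Nat.lt_succ_iff]
    rcases List.mem_cons.1 h with rfl | h
    · exact Nat.left_le_pair _ _
    · exact (ih h).le.trans (Nat.right_le_pair _ _)

/-! ### Gödel numbers of rationals, terms and formulas. -/

namespace RPL

variable {L : Lang}

theorem UnitRat.code_injective : Function.Injective UnitRat.code := by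
  intro r s h
  obtain ⟨h1, h2⟩ := Nat.pair_eq_pair.1 h
  refine Subtype.ext (Rat.ext ?_ h2)
  have hr := Rat.num_nonneg.2 r.2.1
  have hs := Rat.num_nonneg.2 s.2.1
  omega

theorem UnitRat.exists_code_eq {n : ℕ} : (∃ r : UnitRat, r.code = n) ↔
    0 < n.unpair.2 ∧ n.unpair.1 ≤ n.unpair.2 ∧ Nat.Coprime n.unpair.1 n.unpair.2 := by
  constructor
  · rintro ⟨r, rfl⟩
    have hr := Rat.num_nonneg.2 r.2.1
    have h1 := Rat.num_le_denom_iff.2 r.2.2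
    simp only [UnitRat.code, Nat.unpair_pair]
    exact ⟨r.1.den_pos, by omega, r.1.reduced⟩
  · rintro ⟨h0, h1, h2⟩
    refine ⟨⟨⟨n.unpair.1, n.unpair.2, h0.ne', by simpa using h2⟩, ?_, ?_⟩, ?_⟩
    · exact Rat.num_nonneg.1 (by simp)
    · exact Rat.num_le_denom_iff.1 (by simpa using h1)
    · simp [UnitRat.code]

/-- Decision of the Gödel numbers of rationals in `[0,1]`. -/
def UnitRat.isCode (n : ℕ) : Bool :=
  Nat.ble 1 n.unpair.2 && n.unpair.1.ble n.unpair.2 && decide (Nat.Coprime n.unpair.1 n.unpair.2)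

theorem UnitRat.isCode_iff {n : ℕ} : UnitRat.isCode n = true ↔ ∃ r : UnitRat, r.code = n := by
  rw [UnitRat.exists_code_eq]
  simp only [UnitRat.isCode, Bool.and_eq_true, Nat.ble_eq, decide_eq_true_eq, and_assoc]
  rfl

@[fun_prop] theorem UnitRat.computable_isCode : Computable UnitRat.isCode := by
  have : Computable fun n : ℕ => decide (Nat.Coprime n.unpair.1 n.unpair.2) :=
    Computable.decide_coprime.comp (g := Nat.unpair) Computable.unpair
  unfold UnitRat.isCode
  fun_prop

namespace Term

theorem code_injective : Function.Injective (code : Term L → ℕ) := by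
  intro s
  induction s with
  | var x => intro t h; cases t <;> simp [code] at h ⊢; exact h
  | const c =>
    intro t h; cases t <;> simp [code] at h ⊢; exact Subtype.ext h
  | func f a ih =>
    intro t h
    cases t with
    | var => simp [code] at h
    | const => simp [code] at h
    | func g b =>
      simp only [code, Nat.pair_eq_pair, true_and] at h
      obtain ⟨h1, h2⟩ := h
      obtain rfl : f = g := Subtype.ext h1
      congr 1
      have := List.ofFn_injective (Encodable.encode_injective h2)
      exact funext fun i => ih i (congrFun this i)

/-- The list of the variables that occur in the term. -/
def fv : Term L → List ℕ
  | var y => [y]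
  | const _ => []
  | func _ a => (List.ofFn fun i => (a i).fv).flatten

theorem mem_fv {x : ℕ} : ∀ {t : Term L}, x ∈ t.fv ↔ t.Occurs x
  | var y => by simp [fv, Occurs, eq_comm]
  | const _ => by simp [fv, Occurs]
  | func f a => by
    simp only [fv, Occurs, List.mem_flatten, List.mem_ofFn]
    constructor
    · rintro ⟨_, ⟨i, rfl⟩, h⟩; exact ⟨i, mem_fv.1 h⟩
    · rintro ⟨i, h⟩; exact ⟨_, ⟨i, rfl⟩, mem_fv.2 h⟩

/-- Substitution on Gödel numbers. -/
def substCode (x s : ℕ) : Term L → ℕ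
  | var y => if y = x then s else (var y : Term L).code
  | const c => (const c).code
  | func f a => Nat.pair 2 (Nat.pair f.1 (Encodable.encode (List.ofFn fun i => substCode x s (a i))))

theorem substCode_code (x : ℕ) (s : Term L) : ∀ t : Term L,
    substCode x s.code t = (subst x s t).code
  | var y => by simp only [substCode, subst]; split_ifs <;> rfl
  | const c => rfl
  | func f a => by simp only [substCode, subst, code, substCode_code x s]

/-- The effective data of the term with Gödel number `n`: the Gödel number after substitution and
the list of variables. -/
noncomputable def data (L : Lang) (p : ℕ × ℕ) (n : ℕ) : Option (ℕ × List ℕ) :=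
  (Function.partialInv (code : Term L → ℕ) n).map fun t => (t.substCode p.1 p.2, t.fv)

theorem data_code (p : ℕ × ℕ) (t : Term L) :
    data L p t.code = some (t.substCode p.1 p.2, t.fv) := by
  simp [data, Function.partialInv_left code_injective]

theorem isSome_data {p : ℕ × ℕ} {n : ℕ} : (data L p n).isSome = true ↔ ∃ t : Term L, t.code = n := by
  constructor
  · intro h
    obtain ⟨r, hr⟩ := Option.isSome_iff_exists.1 h
    obtain ⟨t, ht, -⟩ := Option.map_eq_some_iff.1 hr
    exact ⟨t, (Function.Injective.isPartialInv code_injective t n).1 ht⟩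
  · rintro ⟨t, rfl⟩
    simp [data_code]

theorem exists_ofFn_code {l : List ℕ} {p : ℕ × ℕ} {rs : List (ℕ × List ℕ)} {n : ℕ}
    (h : l.collect (data L p) = some rs) (hn : l.length = n) :
    ∃ a : Fin n → Term L, (List.ofFn fun i => (a i).code) = l := by
  have h1 := List.isSome_of_collect h
  subst hn
  have h2 : ∀ i : Fin l.length, ∃ t : Term L, t.code = l[i] := fun i =>
    isSome_data.1 (h1 _ (List.getElem_mem i.2))
  choose a ha using h2
  exact ⟨a, by simp only [ha]; exact List.ofFn_getElem⟩

/-- The recursion step for `data`, in terms of decisions of the sets of symbols. -/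
def dataStep (isC isF : ℕ → Bool) (ar : ℕ → ℕ) (p : ℕ × ℕ) (n : ℕ)
    (hist : List (Option (ℕ × List ℕ))) : Option (ℕ × List ℕ) :=
  bif n.unpair.1 == 0 then some (bif n.unpair.2 == p.1 then p.2 else n, [n.unpair.2])
  else bif n.unpair.1 == 1 then (bif isC n.unpair.2 then some (n, []) else none)
  else bif n.unpair.1 == 2 then
    (bif isF n.unpair.2.unpair.1 then
      (bif (Denumerable.ofNat (List ℕ) n.unpair.2.unpair.2).length == ar n.unpair.2.unpair.1 then
        ((Denumerable.ofNat (List ℕ) n.unpair.2.unpair.2).collect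
          fun m => (hist[m]?).getD none).map fun rs =>
            (Nat.pair 2 (Nat.pair n.unpair.2.unpair.1 (Encodable.encode (rs.map fun r => r.1))),
              rs.flatMap fun r => r.2)
      else none)
    else none)
  else none

theorem collect_hist {σ : Type*} (g : ℕ → Option σ) {l : List ℕ} {n : ℕ} (h : ∀ m ∈ l, m < n) :
    l.collect (fun m => (((List.range n).map g)[m]?).getD none) = l.collect g := by
  unfold List.collect
  have h1 : ∀ m ∈ l, (((List.range n).map g)[m]?).getD none = g m := fun m hm => by
    simp [h m hm]
  rw [List.filterMap_congr h1]
  congr 1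
  rw [Bool.eq_iff_iff, List.all_eq_true, List.all_eq_true]
  exact forall₂_congr fun m hm => by simp only [h1 m hm]

/-- `data` is defined by a noncomputable inverse of the coding; this recursion makes it computable.
On a number that is not a code the step fails, because a value in any branch would allow a term with
that code to be assembled. -/
theorem data_eq_dataStep {isC isF : ℕ → Bool} (hC : ∀ n, isC n = true ↔ L.IsConst n)
    (hF : ∀ n, isF n = true ↔ L.IsFunc n) (p : ℕ × ℕ) (n : ℕ) :
    data L p n = dataStep isC isF L.funcArity p n ((List.range n).map (data L p)) := by
  by_cases h : ∃ t : Term L, t.code = n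
  · obtain ⟨t, rfl⟩ := h
    rw [data_code]
    cases t with
    | var y => simp [dataStep, code, substCode, fv, Bool.cond_eq_ite]
    | const c =>
      have := (hC c.1).2 c.2
      simp [dataStep, code, substCode, fv, this]
    | func f a =>
      have hf := (hF f.1).2 f.2
      unfold dataStep
      rw [collect_hist]
      · simp only [code, Nat.unpair_pair, Denumerable.ofNat_encode, hf, cond_true, List.length_ofFn]
        rw [List.collect_ofFn (d := fun i => ((a i).substCode p.1 p.2, (a i).fv))
          (fun i => data_code p (a i))]
        simp [substCode, fv, List.map_ofFn, Function.comp_def, List.flatMap_def]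
      · intro m hm
        simp only [code, Nat.unpair_pair, Denumerable.ofNat_encode] at hm ⊢
        exact Nat.lt_pair_of_pos two_pos ((List.lt_encode_of_mem hm).le.trans
          (Nat.right_le_pair _ _))
  · have h1 : data L p n = none := by
      rw [← Option.not_isSome_iff_eq_none, isSome_data]; exact h
    rw [h1]
    symm
    rw [Option.eq_none_iff_forall_ne_some]
    intro r hr
    apply h
    simp only [dataStep, Bool.cond_eq_ite, beq_iff_eq, hC, hF] at hr
    by_cases c0 : n.unpair.1 = 0
    · exact ⟨var n.unpair.2, by rw [code, ← c0, Nat.pair_unpair]⟩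
    rw [if_neg c0] at hr
    by_cases c1 : n.unpair.1 = 1
    · rw [if_pos c1] at hr
      split_ifs at hr with c
      exact ⟨const ⟨n.unpair.2, (hC _).1 c⟩, by simp only [code]; rw [← c1, Nat.pair_unpair]⟩
    rw [if_neg c1] at hr
    split_ifs at hr with c2 c3 c4
    rw [collect_hist] at hr
    · obtain ⟨rs, hrs, -⟩ := Option.map_eq_some_iff.1 hr
      obtain ⟨a, ha⟩ := exists_ofFn_code hrs c4
      refine ⟨func ⟨_, (hF _).1 c3⟩ a, ?_⟩
      simp only [code, ha, Denumerable.encode_ofNat, Nat.pair_unpair]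
      rw [← c2, Nat.pair_unpair]
    · intro m hm
      have h2 := List.lt_encode_of_mem hm
      rw [Denumerable.encode_ofNat] at h2
      have h3 := Nat.unpair_right_le n.unpair.2
      have h4 := Nat.unpair_right_le n
      omega

theorem computable_data (hL : L.ComputablyGiven) :
    Computable fun x : (ℕ × ℕ) × ℕ => data L x.1 x.2 := by
  obtain ⟨isC, hC, hC'⟩ := ComputablePred.computable_iff.1 hL.const
  obtain ⟨isF, hF, hF'⟩ := ComputablePred.computable_iff.1 hL.func
  have hA := hL.funcArity
  -- The history of values below `n` has length `n`, so `l.length` recovers the argument.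
  refine Computable.of_strong_rec (fun p l => dataStep isC isF L.funcArity p l.length l) ?_
    fun p n => ?_
  · unfold dataStep
    fun_prop
  · simpa using data_eq_dataStep (fun n => by rw [hC']) (fun n => by rw [hF']) p n

/-- The set of the Gödel numbers of closed terms is decidable. -/
theorem computablePred_closed (hL : L.ComputablyGiven) :
    ComputablePred fun n => ∃ t : ClosedTerm L, t.1.code = n := by
  have hd := computable_data hL
  -- The substitution parameters are dummies; only the list of variables is used.
  have : Computable fun n => (data L (0, 0) n).elim false (fun r => r.2.length == 0) := by
    fun_prop
  refine ComputablePred.of_eq (ComputablePred.computable_iff.2 ⟨_, this, rfl⟩) fun n => ?_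
  constructor
  · intro h
    have h1 : (data L (0, 0) n).isSome = true := by
      cases hn : data L (0, 0) n <;> simp [hn] at h ⊢
    obtain ⟨t, rfl⟩ := isSome_data.1 h1
    simp only [data_code, Option.elim_some, beq_iff_eq, List.length_eq_zero_iff] at h
    exact ⟨⟨t, fun x hx => by simpa [h] using mem_fv.2 hx⟩, rfl⟩
  · rintro ⟨t, rfl⟩
    simp only [data_code, Option.elim_some, beq_iff_eq, List.length_eq_zero_iff]
    exact List.eq_nil_iff_forall_not_mem.2 fun x hx => t.2 x (mem_fv.1 hx)

end Term

namespace Formula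

theorem code_injective : Function.Injective (code : Formula L → ℕ) := by
  intro φ
  induction φ with
  | rat r => intro ψ h; cases ψ <;> simp [code] at h ⊢; exact UnitRat.code_injective h
  | sim s t =>
    intro ψ h; cases ψ <;> simp [code] at h ⊢
    exact ⟨Term.code_injective h.1, Term.code_injective h.2⟩
  | rel R a =>
    intro ψ h
    cases ψ with
    | rel R' b =>
      simp only [code, Nat.pair_eq_pair, true_and] at h
      obtain ⟨h1, h2⟩ := h
      obtain rfl : R = R' := Subtype.ext h1
      congr 1
      have := List.ofFn_injective (Encodable.encode_injective h2)
      exact funext fun i => Term.code_injective (congrFun this i)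
    | _ => simp [code] at h
  | imp φ ψ ih1 ih2 =>
    intro χ h; cases χ <;> simp [code] at h ⊢
    exact ⟨ih1 h.1, ih2 h.2⟩
  | all y φ ih =>
    intro χ h; cases χ <;> simp [code] at h ⊢
    exact ⟨h.1, ih h.2⟩

/-- The list of the free variables. -/
def fv : Formula L → List ℕ
  | rat _ => []
  | sim s t => s.fv ++ t.fv
  | rel _ a => (List.ofFn fun i => (a i).fv).flatten
  | imp φ ψ => φ.fv ++ ψ.fv
  | all y φ => φ.fv.filter fun x => !(y == x)

theorem mem_fv {x : ℕ} {φ : Formula L} : x ∈ φ.fv ↔ φ.Free x := by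
  induction φ with
  | rat r => simp [fv, Free]
  | sim s t => simp [fv, Free, Term.mem_fv]
  | rel R a =>
    simp only [fv, Free, List.mem_flatten, List.mem_ofFn]
    constructor
    · rintro ⟨_, ⟨i, rfl⟩, h⟩; exact ⟨i, Term.mem_fv.1 h⟩
    · rintro ⟨i, h⟩; exact ⟨_, ⟨i, rfl⟩, Term.mem_fv.2 h⟩
  | imp φ ψ ih1 ih2 => simp [fv, Free, ih1, ih2]
  | all y φ ih => simp [fv, Free, ih, and_comm]

/-- Substitution on Gödel numbers. -/
def substCode (x s : ℕ) : Formula L → ℕ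
  | rat r => (rat r : Formula L).code
  | sim t u => Nat.pair 1 (Nat.pair (t.substCode x s) (u.substCode x s))
  | rel R a =>
    Nat.pair 2 (Nat.pair R.1 (Encodable.encode (List.ofFn fun i => (a i).substCode x s)))
  | imp φ ψ => Nat.pair 3 (Nat.pair (φ.substCode x s) (ψ.substCode x s))
  | all y φ => if y = x then (all y φ).code else Nat.pair 4 (Nat.pair y (φ.substCode x s))

theorem substCode_code (x : ℕ) (s : Term L) (φ : Formula L) :
    substCode x s.code φ = (φ.subst x s).code := by
  induction φ with
  | rat r => rfl
  | sim t u => simp only [substCode, subst, code, Term.substCode_code]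
  | rel R a => simp only [substCode, subst, code, Term.substCode_code]
  | imp φ ψ ih1 ih2 => simp only [substCode, subst, code, ih1, ih2]
  | all y φ ih => simp only [substCode, subst]; split_ifs <;> simp [code, ih]

/-- Decision of `FreeFor`, where `S` lists the variables of the term. -/
def freeForBool (x : ℕ) (S : List ℕ) : Formula L → Bool
  | rat _ => true
  | sim _ _ => true
  | rel _ _ => true
  | imp φ ψ => φ.freeForBool x S && ψ.freeForBool x S
  | all y φ => y == x || !φ.fv.elem x || (!S.elem y && φ.freeForBool x S)

theorem freeForBool_fv (x : ℕ) (t : Term L) (φ : Formula L) :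
    φ.freeForBool x t.fv = true ↔ FreeFor t x φ := by
  induction φ with
  | imp φ ψ ih1 ih2 => simp [freeForBool, FreeFor, ih1, ih2]
  | all y φ ih =>
    simp [freeForBool, FreeFor, mem_fv, Term.mem_fv, ih, imp_iff_not_or]
  | _ => simp [freeForBool, FreeFor]

/-- The effective data of the formula with Gödel number `n`: the Gödel number after substitution,
the list of free variables, and whether the substitution is admissible. -/
noncomputable def data (L : Lang) (p : ℕ × ℕ × List ℕ) (n : ℕ) : Option (ℕ × List ℕ × Bool) :=
  (Function.partialInv (code : Formula L → ℕ) n).map fun φ =>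
    (φ.substCode p.1 p.2.1, φ.fv, φ.freeForBool p.1 p.2.2)

theorem data_code (p : ℕ × ℕ × List ℕ) (φ : Formula L) :
    data L p φ.code = some (φ.substCode p.1 p.2.1, φ.fv, φ.freeForBool p.1 p.2.2) := by
  simp [data, Function.partialInv_left code_injective]

theorem isSome_data {p : ℕ × ℕ × List ℕ} {n : ℕ} :
    (data L p n).isSome = true ↔ ∃ φ : Formula L, φ.code = n := by
  constructor
  · intro h
    obtain ⟨r, hr⟩ := Option.isSome_iff_exists.1 h
    obtain ⟨t, ht, -⟩ := Option.map_eq_some_iff.1 hr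
    exact ⟨t, (Function.Injective.isPartialInv code_injective t n).1 ht⟩
  · rintro ⟨t, rfl⟩
    simp [data_code]

/-- The recursion step for `data`, in terms of decisions of the sets of symbols. -/
noncomputable def dataStep (L : Lang) (isR : ℕ → Bool) (ar : ℕ → ℕ) (p : ℕ × ℕ × List ℕ) (n : ℕ)
    (hist : List (Option (ℕ × List ℕ × Bool))) : Option (ℕ × List ℕ × Bool) :=
  bif n.unpair.1 == 0 then
    (bif UnitRat.isCode n.unpair.2 then some (n, [], true) else none)
  else bif n.unpair.1 == 1 then
    (Term.data L (p.1, p.2.1) n.unpair.2.unpair.1).bind fun r =>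
      (Term.data L (p.1, p.2.1) n.unpair.2.unpair.2).map fun r' =>
        (Nat.pair 1 (Nat.pair r.1 r'.1), r.2 ++ r'.2, true)
  else bif n.unpair.1 == 2 then
    (bif isR n.unpair.2.unpair.1 then
      (bif (Denumerable.ofNat (List ℕ) n.unpair.2.unpair.2).length == ar n.unpair.2.unpair.1 then
        ((Denumerable.ofNat (List ℕ) n.unpair.2.unpair.2).collect
          fun m => Term.data L (p.1, p.2.1) m).map fun rs =>
            (Nat.pair 2 (Nat.pair n.unpair.2.unpair.1 (Encodable.encode (rs.map fun r => r.1))),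
              rs.flatMap fun r => r.2, true)
      else none)
    else none)
  else bif n.unpair.1 == 3 then
    ((hist[n.unpair.2.unpair.1]?).getD none).bind fun r =>
      ((hist[n.unpair.2.unpair.2]?).getD none).map fun r' =>
        (Nat.pair 3 (Nat.pair r.1 r'.1), r.2.1 ++ r'.2.1, r.2.2 && r'.2.2)
  else bif n.unpair.1 == 4 then
    ((hist[n.unpair.2.unpair.2]?).getD none).map fun r =>
      (bif n.unpair.2.unpair.1 == p.1 then n else Nat.pair 4 (Nat.pair n.unpair.2.unpair.1 r.1),
        r.2.1.filter fun x => !(n.unpair.2.unpair.1 == x),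
        n.unpair.2.unpair.1 == p.1 || !r.2.1.elem p.1 ||
          (!p.2.2.elem n.unpair.2.unpair.1 && r.2.2))
  else none

/-- As for terms: atomic formulas use the computable `Term.data`, and only subformulas are looked up
in the history. -/
theorem data_eq_dataStep {isR : ℕ → Bool} (hR : ∀ n, isR n = true ↔ L.IsRel n) (p : ℕ × ℕ × List ℕ) (n : ℕ) :
    data L p n = dataStep L isR L.relArity p n ((List.range n).map (data L p)) := by
  have hget : ∀ m < n, (((List.range n).map (data L p))[m]?).getD none = data L p m := fun m hm => by
    simp [hm]
  have hlt : ∀ m, 0 < n.unpair.1 → m ≤ n.unpair.2 → m < n := fun m h0 hm => by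
    have := Nat.lt_pair_of_pos h0 hm
    rwa [Nat.pair_unpair] at this
  by_cases h : ∃ t : Formula L, t.code = n
  · obtain ⟨φ, rfl⟩ := h
    rw [data_code]
    cases φ with
    | rat r =>
      have := UnitRat.isCode_iff.2 ⟨r, rfl⟩
      simp [dataStep, code, substCode, fv, freeForBool, this]
    | sim s t =>
      simp [dataStep, code, Term.data_code, substCode, fv, freeForBool]
    | rel R a =>
      have hf := (hR R.1).2 R.2
      simp only [dataStep, code, Nat.unpair_pair, Denumerable.ofNat_encode, hf, cond_true, List.length_ofFn]
      simp only [beq_self_eq_true, cond_true]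
      rw [List.collect_ofFn (d := fun i => ((a i).substCode p.1 p.2.1, (a i).fv))
        (fun i => Term.data_code (p.1, p.2.1) (a i))]
      simp [substCode, fv, freeForBool, List.map_ofFn, Function.comp_def, List.flatMap_def]
    | imp φ ψ =>
      have h1 := hget _ (hlt φ.code (by simp [code])
        (by simp only [code, Nat.unpair_pair]; exact Nat.left_le_pair _ _))
      have h2 := hget _ (hlt ψ.code (by simp [code])
        (by simp only [code, Nat.unpair_pair]; exact Nat.right_le_pair _ _))
      rw [data_code] at h1 h2
      unfold dataStep
      generalize (List.range _).map (data L p) = hist at h1 h2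
      simp [code, h1, h2, substCode, fv, freeForBool]
    | all y φ =>
      have h1 := hget _ (hlt φ.code (by simp [code])
        (by simp only [code, Nat.unpair_pair]; exact Nat.right_le_pair _ _))
      rw [data_code] at h1
      unfold dataStep
      generalize (List.range _).map (data L p) = hist at h1
      simp [code, h1, substCode, fv, freeForBool, Bool.cond_eq_ite]
  · have h1 : data L p n = none := by
      rw [← Option.not_isSome_iff_eq_none, isSome_data]; exact h
    rw [h1]
    symm
    rw [Option.eq_none_iff_forall_ne_some]
    intro r hr
    apply h
    simp only [dataStep, Bool.cond_eq_ite (_ == _), Bool.cond_eq_ite (isR _),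
      Bool.cond_eq_ite (UnitRat.isCode _), beq_iff_eq, hR, UnitRat.isCode_iff] at hr
    by_cases c0 : n.unpair.1 = 0
    · rw [if_pos c0] at hr
      split_ifs at hr with c
      obtain ⟨q, hq⟩ := UnitRat.isCode_iff.1 c
      exact ⟨rat q, by rw [code, hq, ← c0, Nat.pair_unpair]⟩
    rw [if_neg c0] at hr
    by_cases c1 : n.unpair.1 = 1
    · rw [if_pos c1] at hr
      obtain ⟨r1, h1, hr⟩ := Option.bind_eq_some_iff.1 hr
      obtain ⟨r2, h2, -⟩ := Option.map_eq_some_iff.1 hr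
      obtain ⟨s, hs⟩ := Term.isSome_data.1 (Option.isSome_of_mem h1)
      obtain ⟨t, ht⟩ := Term.isSome_data.1 (Option.isSome_of_mem h2)
      exact ⟨sim s t, by rw [code, hs, ht, Nat.pair_unpair, ← c1, Nat.pair_unpair]⟩
    rw [if_neg c1] at hr
    by_cases c2 : n.unpair.1 = 2
    · rw [if_pos c2] at hr
      split_ifs at hr with c3 c4
      obtain ⟨rs, hrs, -⟩ := Option.map_eq_some_iff.1 hr
      obtain ⟨a, ha⟩ := Term.exists_ofFn_code hrs c4
      refine ⟨rel ⟨_, (hR _).1 c3⟩ a, ?_⟩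
      simp only [code, ha, Denumerable.encode_ofNat, Nat.pair_unpair]
      rw [← c2, Nat.pair_unpair]
    rw [if_neg c2] at hr
    by_cases c3 : n.unpair.1 = 3
    · rw [if_pos c3, hget _ (hlt _ (by omega) (Nat.unpair_left_le _)),
        hget _ (hlt _ (by omega) (Nat.unpair_right_le _))] at hr
      obtain ⟨r1, h1, hr⟩ := Option.bind_eq_some_iff.1 hr
      obtain ⟨r2, h2, -⟩ := Option.map_eq_some_iff.1 hr
      obtain ⟨s, hs⟩ := isSome_data.1 (Option.isSome_of_mem h1)
      obtain ⟨t, ht⟩ := isSome_data.1 (Option.isSome_of_mem h2)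
      exact ⟨imp s t, by rw [code, hs, ht, Nat.pair_unpair, ← c3, Nat.pair_unpair]⟩
    rw [if_neg c3] at hr
    by_cases c4 : n.unpair.1 = 4
    · rw [if_pos c4, hget _ (hlt _ (by omega) (Nat.unpair_right_le _))] at hr
      obtain ⟨r2, h2, -⟩ := Option.map_eq_some_iff.1 hr
      obtain ⟨t, ht⟩ := isSome_data.1 (Option.isSome_of_mem h2)
      exact ⟨all n.unpair.2.unpair.1 t, by rw [code, ht, Nat.pair_unpair, ← c4, Nat.pair_unpair]⟩
    · rw [if_neg c4] at hr
      simp at hr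

theorem computable_data (hL : L.ComputablyGiven) :
    Computable fun x : (ℕ × ℕ × List ℕ) × ℕ => data L x.1 x.2 := by
  obtain ⟨isR, hR, hR'⟩ := ComputablePred.computable_iff.1 hL.rel
  have hA := hL.relArity
  have hT := Term.computable_data hL
  refine Computable.of_strong_rec (fun p l => dataStep L isR L.relArity p l.length l) ?_
    fun p n => ?_
  · unfold dataStep
    fun_prop
  · simpa using data_eq_dataStep (fun n => by rw [hR']) p n

end Formula

end RPL

/-! ### Enumerability of the theorems. -/

namespace RPL

variable {L : Lang}

namespace UnitRat

theorem val_mul_den (r : UnitRat) : r.1 * (r.1.den : ℚ) = (r.1.num.natAbs : ℚ) := by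
  have h : ((r.1.num.natAbs : ℤ) : ℚ) = (r.1.num : ℚ) := by
    rw [Int.natAbs_of_nonneg (Rat.num_nonneg.2 r.2.1)]
  rw [Int.cast_natCast] at h
  rw [h, Rat.mul_den_eq_num]

/-- After clearing denominators, truncated subtraction of natural numbers plays the role of `max (s
- r) 0`. This lets bookkeeping instances be decided from codes alone. -/
theorem eq_tsub_iff (r s t : UnitRat) : t = s.tsub r ↔
    t.1.num.natAbs * (r.1.den * s.1.den) =
      t.1.den * (s.1.num.natAbs * r.1.den - r.1.num.natAbs * s.1.den) := by
  have hr : (0 : ℚ) < r.1.den := by exact_mod_cast r.1.den_pos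
  have hs : (0 : ℚ) < s.1.den := by exact_mod_cast s.1.den_pos
  have ht : (0 : ℚ) < t.1.den := by exact_mod_cast t.1.den_pos
  have key : ((s.1.num.natAbs * r.1.den - r.1.num.natAbs * s.1.den : ℕ) : ℚ)
      = max (s.1 - r.1) 0 * (r.1.den * s.1.den) := by
    have e : (s.1 - r.1) * (r.1.den * s.1.den)
        = (s.1.num.natAbs * r.1.den : ℕ) - (r.1.num.natAbs * s.1.den : ℕ) := by
      push_cast
      rw [← val_mul_den r, ← val_mul_den s]
      ring
    rw [max_mul_of_nonneg _ _ (by positivity), e, zero_mul]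
    rcases le_total (r.1.num.natAbs * s.1.den) (s.1.num.natAbs * r.1.den) with h | h
    · rw [Nat.cast_sub h, max_eq_left]
      rw [sub_nonneg]; exact_mod_cast h
    · rw [Nat.sub_eq_zero_of_le h, max_eq_right, Nat.cast_zero]
      rw [sub_nonpos]; exact_mod_cast h
  rw [Subtype.ext_iff, ← Nat.cast_inj (R := ℚ)]
  push_cast [key]
  change t.1 = max (s.1 - r.1) 0 ↔ _
  have e := (val_mul_den t).symm
  rw [e]
  constructor
  · intro h; rw [← h]; ring
  · intro h
    have : (0 : ℚ) < t.1.den * (r.1.den * s.1.den) := by positivity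
    apply mul_right_cancel₀ this.ne'
    linarith

end UnitRat

namespace Formula

/-- Gödel number of an implication. -/
def impCode (a b : ℕ) : ℕ := Nat.pair 3 (Nat.pair a b)

/-- Gödel number of a negation. -/
def negCode (a : ℕ) : ℕ := impCode a (Nat.pair 0 (Nat.pair 1 1))

/-- Gödel number of `φ ⊕ ψ`. -/
def oplusCode (a b : ℕ) : ℕ := negCode (impCode a (negCode b))

/-- Gödel number of a generalization. -/
def allCode (x a : ℕ) : ℕ := Nat.pair 4 (Nat.pair x a)

theorem code_rat (r : UnitRat) : (rat r : Formula L).code = Nat.pair 0 r.code := rfl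

theorem code_sim (s t : Term L) : (sim s t).code = Nat.pair 1 (Nat.pair s.code t.code) := rfl

theorem _root_.RPL.Term.code_var (x : ℕ) : (Term.var x : Term L).code = Nat.pair 0 x := rfl

theorem code_imp (φ ψ : Formula L) : (imp φ ψ).code = impCode φ.code ψ.code := rfl

theorem code_bot : (bot : Formula L).code = Nat.pair 0 (Nat.pair 1 1) := by
  simp [bot, code, UnitRat.code]

theorem code_neg (φ : Formula L) : (neg φ).code = negCode φ.code := by
  rw [neg, code_imp, code_bot, negCode]

theorem code_oplus (φ ψ : Formula L) : (oplus φ ψ).code = oplusCode φ.code ψ.code := by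
  rw [oplus, code_neg, code_imp, code_neg, oplusCode]

theorem code_all (x : ℕ) (φ : Formula L) : (all x φ).code = allCode x φ.code := rfl

end Formula

open Formula

section
variable {α : Type*} [Primcodable α]

@[fun_prop] theorem comp_impCode {f g : α → ℕ} (hf : Computable f) (hg : Computable g) :
    Computable fun a => impCode (f a) (g a) := by unfold impCode; fun_prop

@[fun_prop] theorem comp_negCode {f : α → ℕ} (hf : Computable f) :
    Computable fun a => negCode (f a) := by unfold negCode; fun_prop

@[fun_prop] theorem comp_oplusCode {f g : α → ℕ} (hf : Computable f) (hg : Computable g) :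
    Computable fun a => oplusCode (f a) (g a) := by unfold oplusCode; fun_prop

@[fun_prop] theorem comp_allCode {f g : α → ℕ} (hf : Computable f) (hg : Computable g) :
    Computable fun a => allCode (f a) (g a) := by unfold allCode; fun_prop

end

/-- Decision of the Gödel numbers of formulas. -/
noncomputable def isFormulaCode (L : Lang) (n : ℕ) : Bool := (Formula.data L (0, 0, []) n).isSome

theorem isFormulaCode_iff {n : ℕ} : isFormulaCode L n = true ↔ ∃ φ : Formula L, φ.code = n :=
  Formula.isSome_data

theorem computable_isFormulaCode (hL : L.ComputablyGiven) : Computable (isFormulaCode L) := by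
  have := Formula.computable_data hL
  unfold isFormulaCode
  fun_prop

/-- Decides whether `p.1` is the Gödel number of the instance of a logical schema with the
parameters `p.2`. -/
noncomputable def schemaTest (L : Lang) (p : ℕ × ℕ × ℕ × ℕ) : Bool :=
  (isFormulaCode L p.2.1 && isFormulaCode L p.2.2.1 &&
    p.1 == impCode p.2.1 (impCode p.2.2.1 p.2.1)) ||
  ((isFormulaCode L p.2.1 && isFormulaCode L p.2.2.1 && isFormulaCode L p.2.2.2 &&
    p.1 == impCode (impCode p.2.1 p.2.2.1) (impCode (impCode p.2.2.1 p.2.2.2)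
      (impCode p.2.1 p.2.2.2))) ||
  ((isFormulaCode L p.2.1 && isFormulaCode L p.2.2.1 &&
    p.1 == impCode (impCode (impCode p.2.1 p.2.2.1) p.2.2.1)
      (impCode (impCode p.2.2.1 p.2.1) p.2.1)) ||
  ((isFormulaCode L p.2.1 && isFormulaCode L p.2.2.1 &&
    p.1 == impCode (impCode (negCode p.2.1) (negCode p.2.2.1)) (impCode p.2.2.1 p.2.1)) ||
  -- For `all1` the parameters are the codes of formula and term and the variable. The variables
  -- `t.2` of the term enter the test of admissibility, and `r` returns the substituted code with
  -- the result of that test.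
  (((Term.data L (0, 0) p.2.2.1).elim false fun t =>
    (Formula.data L (p.2.2.2, p.2.2.1, t.2) p.2.1).elim false fun r =>
      r.2.2 && p.1 == impCode (allCode p.2.2.2 p.2.1) r.1) ||
  ((isFormulaCode L p.2.2.1 && (Formula.data L (0, 0, []) p.2.1).elim false fun r =>
    !r.2.1.elem p.2.2.2 && p.1 == impCode (allCode p.2.2.2 (impCode p.2.1 p.2.2.1))
      (impCode p.2.1 (allCode p.2.2.2 p.2.2.1))) ||
  -- The third parameter must be the code of the truncated difference; the equation is that of
  -- `UnitRat.eq_tsub_iff`.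
  ((UnitRat.isCode p.2.1 && UnitRat.isCode p.2.2.1 && UnitRat.isCode p.2.2.2 &&
    p.2.2.2.unpair.1 * (p.2.1.unpair.2 * p.2.2.1.unpair.2) ==
      p.2.2.2.unpair.2 * (p.2.2.1.unpair.1 * p.2.1.unpair.2 - p.2.1.unpair.1 * p.2.2.1.unpair.2) &&
    p.1 == oplusCode
      (impCode (impCode (Nat.pair 0 p.2.1) (Nat.pair 0 p.2.2.1)) (Nat.pair 0 p.2.2.2))
      (impCode (Nat.pair 0 p.2.2.2) (impCode (Nat.pair 0 p.2.1) (Nat.pair 0 p.2.2.1)))) ||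
  (p.1 == Nat.pair 1 (Nat.pair (Nat.pair 0 p.2.1) (Nat.pair 0 p.2.1)) ||
  (p.1 == impCode (Nat.pair 1 (Nat.pair (Nat.pair 0 p.2.1) (Nat.pair 0 p.2.2.1)))
      (Nat.pair 1 (Nat.pair (Nat.pair 0 p.2.2.1) (Nat.pair 0 p.2.1))) ||
  p.1 == impCode (oplusCode (Nat.pair 1 (Nat.pair (Nat.pair 0 p.2.1) (Nat.pair 0 p.2.2.1)))
      (Nat.pair 1 (Nat.pair (Nat.pair 0 p.2.2.1) (Nat.pair 0 p.2.2.2))))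
    (Nat.pair 1 (Nat.pair (Nat.pair 0 p.2.1) (Nat.pair 0 p.2.2.2)))))))))))

theorem computable_schemaTest (hL : L.ComputablyGiven) : Computable (schemaTest L) := by
  have h1 := computable_isFormulaCode hL
  have h2 := Term.computable_data hL
  have h3 := Formula.computable_data hL
  unfold schemaTest
  fun_prop

theorem schemaTest_sound (T : Set (Formula L)) {p : ℕ × ℕ × ℕ × ℕ} (h : schemaTest L p = true) :
    ∃ φ, Provable T φ ∧ φ.code = p.1 := by
  obtain ⟨n, a, b, c⟩ := p
  simp only
  simp only [schemaTest, Bool.or_eq_true, Bool.and_eq_true, isFormulaCode_iff, beq_iff_eq,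
    UnitRat.isCode_iff] at h
  rcases h with h | h | h | h | h | h | h | h | h | h
  · obtain ⟨⟨⟨φ, rfl⟩, ⟨ψ, rfl⟩⟩, rfl⟩ := h
    exact ⟨_, .l1 φ ψ, rfl⟩
  · obtain ⟨⟨⟨⟨φ, rfl⟩, ⟨ψ, rfl⟩⟩, ⟨σ, rfl⟩⟩, rfl⟩ := h
    exact ⟨_, .l2 φ ψ σ, rfl⟩
  · obtain ⟨⟨⟨φ, rfl⟩, ⟨ψ, rfl⟩⟩, rfl⟩ := h
    exact ⟨_, .l3 φ ψ, rfl⟩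
  · obtain ⟨⟨⟨φ, rfl⟩, ⟨ψ, rfl⟩⟩, rfl⟩ := h
    exact ⟨_, .l4 φ ψ, by simp only [code_imp, code_bot, negCode]⟩
  · cases hb : Term.data L (0, 0) b with
    | none => simp [hb] at h
    | some t' =>
    obtain ⟨t, rfl⟩ := Term.isSome_data.1 (Option.isSome_of_mem hb)
    cases ha : Formula.data L (c, t.code, t'.2) a with
    | none => simp [hb, ha] at h
    | some r =>
    obtain ⟨φ, rfl⟩ := Formula.isSome_data.1 (Option.isSome_of_mem ha)
    rw [Term.data_code, Option.some_inj] at hb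
    subst hb
    rw [Formula.data_code, Option.some_inj] at ha
    subst ha
    simp only [Term.data_code, Formula.data_code, Option.elim_some, Bool.and_eq_true, beq_iff_eq,
      freeForBool_fv, substCode_code] at h
    exact ⟨_, .all1 c φ t h.1, by simp only [code_imp, code_all, h.2]⟩
  · obtain ⟨⟨ψ, rfl⟩, h⟩ := h
    cases ha : Formula.data L (0, 0, []) a with
    | none => simp [ha] at h
    | some r =>
    obtain ⟨φ, rfl⟩ := Formula.isSome_data.1 (Option.isSome_of_mem ha)
    simp only [Formula.data_code, Option.elim_some, Bool.and_eq_true, beq_iff_eq,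
      Bool.not_eq_true', List.elem_eq_mem, decide_eq_false_iff_not, mem_fv] at h
    exact ⟨_, .all2 c φ ψ h.1, by simp only [code_imp, code_all, h.2]⟩
  · obtain ⟨⟨hc, h⟩, hn⟩ := h
    obtain ⟨⟨⟨r, hr⟩, ⟨s, hs⟩⟩, ⟨t, ht⟩⟩ := hc
    rw [← hr, ← hs, ← ht] at h hn
    simp only [UnitRat.code, Nat.unpair_pair] at h
    obtain rfl := (UnitRat.eq_tsub_iff r s t).2 h
    exact ⟨_, .book r s, by simp only [Formula.iff, code_oplus, code_imp, code_rat, hn]⟩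
  · exact ⟨_, .refl a, by simp only [code_sim, Term.code_var, h]⟩
  · exact ⟨_, .symm a b, by simp only [code_imp, code_sim, Term.code_var, h]⟩
  · exact ⟨_, .trans a b c, by simp only [code_imp, code_oplus, code_sim, Term.code_var, h]⟩

/-- The modus ponens and generalization rules on Gödel numbers. -/
def ruleCode (p : ℕ × ℕ × ℕ) : Option ℕ :=
  -- Parameter `0` is modus ponens; parameter `x + 1` is generalization over `x` of the first
  -- premise, the second premise being ignored.
  bif p.1 == 0 then
    bif p.2.2.unpair.1 == 3 && p.2.2.unpair.2.unpair.1 == p.2.1 then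
      some p.2.2.unpair.2.unpair.2 else none
  else some (allCode (p.1 - 1) p.2.1)

theorem computable_ruleCode : Computable ruleCode := by
  unfold ruleCode
  fun_prop

/-- Provability from a computably axiomatizable theory is computably enumerable. -/
theorem rePred_provable (hL : L.ComputablyGiven) {T : Set (Formula L)}
    (hT : ComputablyAxiomatizable T) : REPred fun n : ℕ => ∃ φ, Provable T φ ∧ φ.code = n := by
  -- The theorems are the closure under the rules of this set: the axioms of `T` together with all
  -- logical axioms.
  have hax : REPred fun n : ℕ => (∃ φ ∈ T, φ.code = n) ∨
      ∃ w : ℕ × ℕ × ℕ, schemaTest L (n, w) = true := by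
    have h1 := computable_schemaTest hL
    refine REPred.or hT (REPred.proj ?_)
    exact REPred.of_computable (q := fun x : ℕ × (ℕ × ℕ × ℕ) => schemaTest L (x.1, x.2))
      (by fun_prop)
  refine (REPred.closure hax computable_ruleCode).of_eq fun n => ⟨fun h => ?_, ?_⟩
  · induction h with
    | base h =>
      rcases h with ⟨φ, hφ, rfl⟩ | ⟨w, hw⟩
      · exact ⟨φ, .ax hφ, rfl⟩
      · exact schemaTest_sound T hw
    | @step k a b c _ _ hc ih1 ih2 =>
      obtain ⟨φ, hφ, rfl⟩ := ih1
      obtain ⟨ψ, hψ, rfl⟩ := ih2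
      rcases Nat.eq_zero_or_pos k with rfl | hk
      · cases hm : (ψ.code.unpair.1 == 3 && ψ.code.unpair.2.unpair.1 == φ.code) with
        | false => simp [ruleCode, hm] at hc
        | true =>
          simp only [ruleCode, hm, cond_true, beq_self_eq_true, Option.some_inj] at hc
          simp only [Bool.and_eq_true, beq_iff_eq] at hm
          cases ψ with
          | imp ψ χ =>
            simp only [code, Nat.unpair_pair, true_and] at hm hc
            obtain rfl := code_injective hm
            exact ⟨χ, .mp hφ hψ, hc⟩
          | _ => simp [code] at hm
      · simp only [ruleCode, beq_eq_false_iff_ne.2 hk.ne', cond_false, Option.some_inj] at hc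
        exact ⟨_, .gen (k - 1) hφ, hc⟩
  · rintro ⟨φ, h, rfl⟩
    have fm : ∀ ψ : Formula L, isFormulaCode L ψ.code = true := fun ψ =>
      isFormulaCode_iff.2 ⟨ψ, rfl⟩
    have rc : ∀ r : UnitRat, UnitRat.isCode r.code = true := fun r => UnitRat.isCode_iff.2 ⟨r, rfl⟩
    have ofTest : ∀ {n : ℕ} (w : ℕ × ℕ × ℕ), schemaTest L (n, w) = true →
      REPred.Closure (fun n : ℕ => (∃ φ ∈ T, φ.code = n) ∨
        ∃ w : ℕ × ℕ × ℕ, schemaTest L (n, w) = true) ruleCode n := fun w h => .base (.inr ⟨w, h⟩)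
    induction h with
    | ax h => exact .base (.inl ⟨_, h, rfl⟩)
    | l1 φ ψ => exact ofTest (φ.code, ψ.code, 0) (by simp [schemaTest, fm, code_imp])
    | l2 φ ψ σ => exact ofTest (φ.code, ψ.code, σ.code) (by simp [schemaTest, fm, code_imp])
    | l3 φ ψ => exact ofTest (φ.code, ψ.code, 0) (by simp [schemaTest, fm, code_imp])
    | l4 φ ψ =>
      exact ofTest (φ.code, ψ.code, 0) (by simp [schemaTest, fm, code_imp, code_bot, negCode])
    | all1 x φ t h =>
      exact ofTest (φ.code, t.code, x) (by
        simp [schemaTest, fm, code_imp, code_all, Term.data_code, Formula.data_code, substCode_code,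
          (freeForBool_fv x t φ).2 h])
    | all2 x φ ψ h =>
      exact ofTest (φ.code, ψ.code, x) (by
        simp [schemaTest, fm, code_imp, code_all, Formula.data_code, mem_fv, h])
    | book r s =>
      have h1 := (UnitRat.eq_tsub_iff r s _).1 rfl
      have h2 : (s.tsub r).code.unpair.1 * (r.code.unpair.2 * s.code.unpair.2) =
        (s.tsub r).code.unpair.2 *
          (s.code.unpair.1 * r.code.unpair.2 - r.code.unpair.1 * s.code.unpair.2) := by
        simpa only [UnitRat.code, Nat.unpair_pair] using h1
      exact ofTest (r.code, s.code, (s.tsub r).code) (by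
        simp [schemaTest, rc, h2, Formula.iff, code_oplus, code_imp, code_rat])
    | refl x => exact ofTest (x, 0, 0) (by simp [schemaTest, code, Term.code])
    | symm x y =>
      exact ofTest (x, y, 0) (by simp only [schemaTest, code_imp]; simp [code, Term.code])
    | trans x y z =>
      exact ofTest (x, y, z) (by simp only [schemaTest, code_imp, code_oplus]; simp [code, Term.code])
    | @mp φ ψ _ _ ih1 ih2 =>
      exact .step (k := 0) ih1 ih2 (by simp [ruleCode, code])
    | gen x _ ih => exact .step (k := x + 1) ih ih (by simp [ruleCode, code_all])

end RPL

/-! ### Derivations in the propositional part and bookkeeping. -/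

namespace RPL

variable {L : Lang} {T : Set (Formula L)}

open Formula

namespace Provable

variable {φ ψ χ : Formula L}

theorem imp_trans (h1 : Provable T (imp φ ψ)) (h2 : Provable T (imp ψ χ)) :
    Provable T (imp φ χ) := .mp h2 (.mp h1 (.l2 φ ψ χ))

theorem imp_intro (ψ : Formula L) (h : Provable T φ) : Provable T (imp ψ φ) := .mp h (.l1 φ ψ)

/-- `l1` gives `φ → ((ψ → φ) → φ)`, and `l3` exchanges the roles of `φ` and `ψ` in its conclusion.
The exchange of premises rests on this. -/
theorem assertion (φ ψ : Formula L) : Provable T (imp φ (imp (imp φ ψ) ψ)) :=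
  (l1 φ (imp ψ φ)).imp_trans (.l3 ψ φ)

theorem imp_left (χ : Formula L) (h : Provable T (imp φ ψ)) :
    Provable T (imp (imp ψ χ) (imp φ χ)) := .mp h (.l2 φ ψ χ)

theorem imp_swap (φ ψ χ : Formula L) :
    Provable T (imp (imp φ (imp ψ χ)) (imp ψ (imp φ χ))) :=
  (l2 φ (imp ψ χ) χ).imp_trans ((assertion ψ χ).imp_left _)

theorem swap (h : Provable T (imp φ (imp ψ χ))) : Provable T (imp ψ (imp φ χ)) :=
  .mp h (imp_swap φ ψ χ)

theorem imp_self (φ : Formula L) : Provable T (imp φ φ) :=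
  .mp (.l1 φ φ) ((l1 φ (imp φ (imp φ φ))).swap)

theorem imp_right (χ : Formula L) (h : Provable T (imp φ ψ)) :
    Provable T (imp (imp χ φ) (imp χ ψ)) := .mp h ((l2 χ φ ψ).swap)

theorem bot_imp (φ : Formula L) : Provable T (imp bot φ) :=
  .mp (imp_intro (imp φ bot) (imp_self bot)) (.l4 φ bot)

theorem double_neg_elim (φ : Formula L) : Provable T (imp (neg (neg φ)) φ) :=
  .mp (bot_imp φ) (l3 φ bot).swap

/-- With `0` as truth, `⊕` is a conjunction. Here `¬φ` implies `φ → ¬ψ`, which `φ ⊕ ψ` refutes;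
double negation elimination finishes. -/
theorem oplus_left (h : Provable T (oplus φ ψ)) : Provable T φ := by
  have h1 : Provable T (imp (neg φ) (imp φ (neg ψ))) := (bot_imp (neg ψ)).imp_right φ
  exact .mp (.mp h (h1.imp_left bot)) (double_neg_elim φ)

theorem oplus_right (h : Provable T (oplus φ ψ)) : Provable T ψ := by
  have h1 : Provable T (imp (neg ψ) (imp φ (neg ψ))) := .l1 _ _
  exact .mp (.mp h (h1.imp_left bot)) (double_neg_elim ψ)

theorem oplus_curry (h : Provable T (imp (oplus φ ψ) χ)) : Provable T (imp φ (imp ψ χ)) := by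
  have h1 : Provable T (imp φ (imp (imp φ (neg ψ)) (neg ψ))) := (imp_self _).swap
  have h2 : Provable T (imp φ (imp ψ (oplus φ ψ))) := h1.imp_trans (imp_swap _ _ _)
  exact h2.imp_trans (h.imp_right ψ)

theorem tsub_of_imp (r s : UnitRat) : Provable T (imp (imp (rat r) (rat s)) (rat (s.tsub r))) :=
  (book r s).oplus_left

theorem imp_of_tsub (r s : UnitRat) : Provable T (imp (rat (s.tsub r)) (imp (rat r) (rat s))) :=
  (book r s).oplus_right

end Provable

theorem UnitRat.tsub_eq_zero {r s : UnitRat} (h : s ≤ r) : s.tsub r = ⟨0, le_rfl, zero_le_one⟩ :=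
  Subtype.ext (max_eq_right (sub_nonpos.2 h))

namespace Provable

theorem rat_zero : Provable T (rat ⟨0, le_rfl, zero_le_one⟩) := by
  have := (imp_self _).mp (tsub_of_imp (T := T) ⟨0, le_rfl, zero_le_one⟩ ⟨0, le_rfl, zero_le_one⟩)
  rwa [UnitRat.tsub_eq_zero le_rfl] at this

/-- A consistent theory proves no truth constant other than `0`. -/
theorem rat_eq_zero (hT : Consistent T) {q : UnitRat} (h : Provable T (rat q)) : q.1 = 0 := by
  by_contra hq
  have hq0 : 0 < q.1 := lt_of_le_of_ne q.2.1 (Ne.symm hq)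
  -- By bookkeeping `s` follows from `s ∸ q` and `q`. Thus all constants up to `n * q` become
  -- provable, and the Archimedean property reaches `1`, which is `⊥`.
  have key : ∀ n : ℕ, ∀ s : UnitRat, s.1 ≤ n * q.1 → Provable T (rat s) := by
    intro n
    induction n with
    | zero =>
      intro s hs
      have : s = ⟨0, le_rfl, zero_le_one⟩ :=
        Subtype.ext (le_antisymm (by simpa using hs) s.2.1)
      rw [this]; exact rat_zero
    | succ n ih =>
      intro s hs
      push_cast at hs
      have h1 : Provable T (rat (s.tsub q)) := by
        apply ih
        change max (s.1 - q.1) 0 ≤ _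
        exact max_le (by linarith) (by positivity)
      exact .mp h (.mp h1 (imp_of_tsub q s))
  obtain ⟨n, hn⟩ := exists_nat_ge (1 / q.1)
  exact hT (key n ⟨1, zero_le_one, le_rfl⟩ ((div_le_iff₀ hq0).1 hn))

theorem rat_le_rat (hT : Consistent T) {r s : UnitRat} (h : Provable T (imp (rat r) (rat s))) :
    s.1 ≤ r.1 := by
  have := rat_eq_zero hT (h.mp (tsub_of_imp r s))
  change max (s.1 - r.1) 0 = 0 at this
  exact sub_nonpos.1 (max_eq_right_iff.1 this)

end Provable

/-! ### Simultaneous substitution of terms. -/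

section Substitution

theorem Term.subst_self (x : ℕ) (t : Term L) : Term.subst x (Term.var x) t = t := by
  induction t with
  | var y => by_cases h : y = x <;> simp [Term.subst, h]
  | const c => rfl
  | func f a ih => simp [Term.subst, ih]

theorem Formula.subst_self (x : ℕ) (φ : Formula L) : φ.subst x (Term.var x) = φ := by
  induction φ with
  | imp φ ψ h1 h2 => simp [Formula.subst, h1, h2]
  | all y φ h => simp [Formula.subst, h]
  | _ => simp [Formula.subst, Term.subst_self]

theorem Formula.freeFor_self (x : ℕ) (φ : Formula L) : FreeFor (Term.var x) x φ := by
  induction φ with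
  | imp φ ψ h1 h2 => exact ⟨h1, h2⟩
  | all y φ h =>
    by_cases hy : y = x
    · exact .inl fun h => h.1 hy
    · exact .inr ⟨fun h => hy h.symm, h⟩
  | _ => trivial

theorem Formula.freeFor_of_closed {t : Term L} (ht : ∀ x, ¬ t.Occurs x) (x : ℕ) (φ : Formula L) :
    FreeFor t x φ := by
  induction φ with
  | imp φ ψ h1 h2 => exact ⟨h1, h2⟩
  | all y φ h => exact .inr ⟨ht y, h⟩
  | _ => trivial

/-- Simultaneous substitution in a term. -/
def Term.msub (σ : ℕ → Term L) : Term L → Term L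
  | Term.var y => σ y
  | Term.const c => Term.const c
  | Term.func f a => Term.func f fun i => (a i).msub σ

/-- Simultaneous substitution for the free variables of a formula. -/
def Formula.msub : (ℕ → Term L) → Formula L → Formula L
  | _, rat r => rat r
  | σ, sim s t => sim (s.msub σ) (t.msub σ)
  | σ, rel R a => rel R fun i => (a i).msub σ
  | σ, imp φ ψ => imp (φ.msub σ) (ψ.msub σ)
  | σ, all y φ => all y (φ.msub (Function.update σ y (Term.var y)))

theorem Term.msub_var (t : Term L) : t.msub Term.var = t := by
  induction t with
  | func f a ih => simp [Term.msub, ih]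
  | _ => rfl

theorem Formula.msub_var (φ : Formula L) : φ.msub Term.var = φ := by
  induction φ with
  | imp φ ψ h1 h2 => simp [Formula.msub, h1, h2]
  | all y φ h => simp [Formula.msub, h]
  | _ => simp [Formula.msub, Term.msub_var]

theorem Term.msub_congr {σ σ' : ℕ → Term L} {t : Term L} (h : ∀ x, t.Occurs x → σ x = σ' x) :
    t.msub σ = t.msub σ' := by
  induction t with
  | var y => exact h y rfl
  | const c => rfl
  | func f a ih => simp only [Term.msub]; congr 1; exact funext fun i => ih i fun x hx => h x ⟨i, hx⟩

theorem Formula.msub_congr {φ : Formula L} {σ σ' : ℕ → Term L} (h : ∀ x, φ.Free x → σ x = σ' x) :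
    φ.msub σ = φ.msub σ' := by
  induction φ generalizing σ σ' with
  | rat r => rfl
  | sim s t =>
    simp only [Formula.msub]
    rw [Term.msub_congr fun x hx => h x (.inl hx), Term.msub_congr fun x hx => h x (.inr hx)]
  | rel R a =>
    simp only [Formula.msub]
    congr 1
    exact funext fun i => Term.msub_congr fun x hx => h x ⟨i, hx⟩
  | imp φ ψ h1 h2 =>
    simp only [Formula.msub]
    rw [h1 fun x hx => h x (.inl hx), h2 fun x hx => h x (.inr hx)]
  | all y φ ih =>
    simp only [Formula.msub]
    congr 1
    refine ih fun x hx => ?_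
    by_cases hxy : x = y
    · simp [hxy]
    · simp [hxy, h x ⟨Ne.symm hxy, hx⟩]

theorem Term.subst_of_not_occurs {x : ℕ} {s t : Term L} (h : ¬ t.Occurs x) : Term.subst x s t = t := by
  induction t with
  | var y => exact if_neg h
  | const c => rfl
  | func f a ih =>
    simp only [Term.subst]; congr 1; exact funext fun i => ih i fun hx => h ⟨i, hx⟩

/-- Since `σ` fixes `y` and its other values avoid `y`, the occurrences of `y` after `σ` are exactly
the original ones. -/
theorem Term.subst_msub {σ : ℕ → Term L} {y : ℕ} (h : ∀ z, z ≠ y → ¬ (σ z).Occurs y)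
    (hy : σ y = Term.var y) (s t : Term L) :
    Term.subst y s (t.msub σ) = t.msub (Function.update σ y s) := by
  induction t with
  | var z =>
    by_cases hz : z = y
    · subst hz; simp [Term.msub, hy, Term.subst]
    · simp [Term.msub, hz, Term.subst_of_not_occurs (h z hz)]
  | const c => rfl
  | func f a ih => simp [Term.msub, Term.subst, ih]

theorem Formula.subst_msub {φ : Formula L} {σ : ℕ → Term L} {y : ℕ}
    (h : ∀ z, z ≠ y → ¬ (σ z).Occurs y) (hy : σ y = Term.var y) (s : Term L) :
    (φ.msub σ).subst y s = φ.msub (Function.update σ y s) := by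
  induction φ generalizing σ with
  | rat r => rfl
  | sim t u => simp [Formula.msub, Formula.subst, Term.subst_msub h hy]
  | rel R a => simp [Formula.msub, Formula.subst, Term.subst_msub h hy]
  | imp φ ψ h1 h2 => simp [Formula.msub, Formula.subst, h1 h hy, h2 h hy]
  | all z φ ih =>
    simp only [Formula.msub, Formula.subst]
    by_cases hz : z = y
    · subst hz; simp
    · rw [if_neg hz, ih, Function.update_comm hz]
      · intro w hw
        by_cases hwz : w = z
        · subst hwz; simpa [Term.Occurs] using hz
        · simpa [hwz] using h w hw
      · simp [Ne.symm hz, hy]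

theorem Term.occurs_msub {σ : ℕ → Term L} {x : ℕ} {t : Term L} (h : (t.msub σ).Occurs x) :
    ∃ z, t.Occurs z ∧ (σ z).Occurs x := by
  induction t with
  | var y => exact ⟨y, rfl, h⟩
  | const c => exact h.elim
  | func f a ih =>
    obtain ⟨i, hi⟩ := h
    obtain ⟨z, hz, hz'⟩ := ih i hi
    exact ⟨z, ⟨i, hz⟩, hz'⟩

theorem Formula.free_msub {φ : Formula L} {σ : ℕ → Term L} {x : ℕ} (h : (φ.msub σ).Free x) :
    ∃ z, φ.Free z ∧ (σ z).Occurs x := by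
  induction φ generalizing σ with
  | rat r => exact h.elim
  | sim s t =>
    rcases h with h | h
    · obtain ⟨z, hz, hz'⟩ := Term.occurs_msub h; exact ⟨z, .inl hz, hz'⟩
    · obtain ⟨z, hz, hz'⟩ := Term.occurs_msub h; exact ⟨z, .inr hz, hz'⟩
  | rel R a =>
    obtain ⟨i, hi⟩ := h
    obtain ⟨z, hz, hz'⟩ := Term.occurs_msub hi
    exact ⟨z, ⟨i, hz⟩, hz'⟩
  | imp φ ψ h1 h2 =>
    rcases h with h | h
    · obtain ⟨z, hz, hz'⟩ := h1 h; exact ⟨z, .inl hz, hz'⟩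
    · obtain ⟨z, hz, hz'⟩ := h2 h; exact ⟨z, .inr hz, hz'⟩
  | all y φ ih =>
    obtain ⟨hyx, h⟩ := h
    obtain ⟨z, hz, hz'⟩ := ih h
    by_cases hzy : z = y
    · subst hzy
      simp only [Function.update_self, Term.Occurs] at hz'
      exact absurd hz' hyx
    · exact ⟨z, ⟨Ne.symm hzy, hz⟩, by simpa [hzy] using hz'⟩

theorem Formula.isSentence_msub {σ : ℕ → Term L} (hσ : ∀ z x, ¬ (σ z).Occurs x) (φ : Formula L) :
    (φ.msub σ).IsSentence := fun _ h => by
  obtain ⟨z, -, hz⟩ := free_msub h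
  exact hσ _ _ hz

/-- The substitution that replaces only the first `n` variables. -/
def truncSub (σ : ℕ → Term L) (n : ℕ) (i : ℕ) : Term L := if i < n then σ i else Term.var i

theorem Formula.msub_truncSub_succ {σ : ℕ → Term L} (hσ : ∀ z x, ¬ (σ z).Occurs x) (n : ℕ)
    (φ : Formula L) : φ.msub (truncSub σ (n + 1)) = (φ.msub (truncSub σ n)).subst n (σ n) := by
  rw [Formula.subst_msub]
  · congr 1
    funext i
    by_cases h : i = n
    · subst h; simp [truncSub]
    · have : i < n + 1 ↔ i < n := by omega
      simp [truncSub, h, this]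
  · intro z hz
    unfold truncSub
    split_ifs
    · exact hσ _ _
    · exact hz
  · simp [truncSub]

theorem Formula.msub_truncSub {σ : ℕ → Term L} {n : ℕ} {φ : Formula L}
    (h : ∀ x, φ.Free x → x < n) : φ.msub (truncSub σ n) = φ.msub σ :=
  Formula.msub_congr fun x hx => if_pos (h x hx)

theorem Formula.exists_bound (φ : Formula L) : ∃ n, ∀ x, φ.Free x → x < n :=
  ⟨φ.fv.sum + 1, fun _ hx => Nat.lt_succ_of_le (List.le_sum_of_mem (mem_fv.2 hx))⟩

theorem Provable.inst {φ : Formula L} (h : Provable T φ) {x : ℕ} {t : Term L}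
    (ht : FreeFor t x φ) : Provable T (φ.subst x t) :=
  .mp (.gen x h) (.all1 x φ t ht)

/-- Closed terms are free for every variable and contain none, so the simultaneous substitution is
reached by generalizing and instantiating one variable at a time, up to a bound on the free
variables. -/
theorem Provable.msub {φ : Formula L} (h : Provable T φ) {σ : ℕ → Term L}
    (hσ : ∀ z x, ¬ (σ z).Occurs x) : Provable T (φ.msub σ) := by
  have key : ∀ n, Provable T (φ.msub (truncSub σ n)) := by
    intro n
    induction n with
    | zero =>
      have : truncSub σ 0 = Term.var := funext fun i => by simp [truncSub]
      rwa [this, Formula.msub_var]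
    | succ n ih =>
      rw [Formula.msub_truncSub_succ hσ]
      exact ih.inst (freeFor_of_closed (hσ _) _ _)
  obtain ⟨n, hn⟩ := φ.exists_bound
  rw [← Formula.msub_truncSub hn]
  exact key n

end Substitution

/-- If `x` is not free in `ψ` and `∀x φ → ψ` is provable, then so is `∃x (φ → ψ)`. -/
theorem Provable.ex_imp {x : ℕ} {φ ψ : Formula L} (hx : ¬ ψ.Free x)
    (h : Provable T (imp (all x φ) ψ)) : Provable T (ex x (imp φ ψ)) := by
  have self : ∀ χ : Formula L, Provable T (imp (all x χ) χ) := fun χ => by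
    have := all1 (T := T) x χ (Term.var x) (freeFor_self x χ)
    rwa [Formula.subst_self] at this
  set B := ex x (imp φ ψ) with hB
  have hBx : ¬ B.Free x := by simp [hB, ex, neg, Free, bot]
  have h0 : Provable T (imp (imp φ ψ) B) := (self (neg (imp φ ψ))).swap
  -- `(α → β) → β` has degree `min ‖α‖ ‖β‖`: it is the lattice disjunction, and `l3` is its
  -- symmetry. The aim is the disjunction of `B` and `ψ`, both of which imply `B`.
  have h2 : Provable T (imp (imp B ψ) (imp (imp ψ φ) φ)) := (h0.imp_left ψ).imp_trans (l3 φ ψ)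
  have h3 : Provable T (imp (imp ψ (all x φ)) (imp ψ φ)) := (self φ).imp_right ψ
  have h5 : Provable T (imp (imp B ψ) (imp (imp ψ (all x φ)) φ)) := h2.imp_trans (h3.imp_left φ)
  -- As `x` is free neither in `B` nor in `ψ`, the quantifier moves inwards past both premises.
  have h6 : Provable T (imp (imp B ψ) (imp (imp ψ (all x φ)) (all x φ))) :=
    (mp (gen x h5) (all2 x _ _ (by simp [Free, hBx, hx]))).imp_trans
      (all2 x _ _ (by simp [Free, hx]))
  have h7 : Provable T (imp (imp B ψ) ψ) := h.mp (h6.imp_trans (l3 ψ (all x φ))).swap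
  -- `ψ` implies `φ → ψ` and hence `B`; so the disjunction `h7` collapses to `B`.
  exact ((l1 ψ φ).imp_trans h0).mp (h7.mp (l3 B ψ))

end RPL

/-! ### Provability degrees as a truth valuation. -/

namespace RPL

variable {L : Lang} {T : Set (Formula L)}

open Formula

section Degree

theorem provDeg_bddBelow (φ : Formula L) :
    BddBelow {x : ℝ | ∃ r : UnitRat, x = ((r.1 : ℚ) : ℝ) ∧ Provable T (imp (rat r) φ)} :=
  ⟨0, by rintro _ ⟨r, rfl, -⟩; exact_mod_cast r.2.1⟩

theorem provDeg_nonempty (φ : Formula L) :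
    {x : ℝ | ∃ r : UnitRat, x = ((r.1 : ℚ) : ℝ) ∧ Provable T (imp (rat r) φ)}.Nonempty :=
  ⟨_, _, rfl, Provable.bot_imp φ⟩

theorem provDeg_le {r : UnitRat} {φ : Formula L} (h : Provable T (imp (rat r) φ)) :
    provDeg T φ ≤ ((r.1 : ℚ) : ℝ) :=
  csInf_le (provDeg_bddBelow φ) ⟨r, rfl, h⟩

theorem provDeg_nonneg (φ : Formula L) : 0 ≤ provDeg T φ :=
  le_csInf (provDeg_nonempty φ) (by rintro _ ⟨r, rfl, -⟩; exact_mod_cast r.2.1)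

theorem provDeg_le_one (φ : Formula L) : provDeg T φ ≤ 1 :=
  (provDeg_le (Provable.bot_imp φ)).trans (by simp)

theorem exists_provable_of_provDeg_lt {φ : Formula L} {x : ℝ} (h : provDeg T φ < x) :
    ∃ r : UnitRat, ((r.1 : ℚ) : ℝ) < x ∧ Provable T (imp (rat r) φ) := by
  obtain ⟨_, ⟨r, rfl, hr⟩, hx⟩ := exists_lt_of_csInf_lt (provDeg_nonempty φ) h
  exact ⟨r, hx, hr⟩

theorem provDeg_anti {φ ψ : Formula L} (h : Provable T (imp φ ψ)) : provDeg T ψ ≤ provDeg T φ :=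
  le_csInf (provDeg_nonempty φ) (by rintro _ ⟨r, rfl, hr⟩; exact provDeg_le (hr.imp_trans h))

theorem provDeg_of_provable {φ : Formula L} (h : Provable T φ) : provDeg T φ = 0 :=
  le_antisymm (by simpa using provDeg_le (r := ⟨0, le_rfl, zero_le_one⟩) (h.imp_intro _))
    (provDeg_nonneg φ)

/-- If `s̄ → φ` is also provable, then so is `s̄ → r̄`, and consistency forces `r ≤ s`. -/
theorem le_provDeg (hT : Consistent T) {r : UnitRat} {φ : Formula L}
    (h : Provable T (imp φ (rat r))) : ((r.1 : ℚ) : ℝ) ≤ provDeg T φ :=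
  le_csInf (provDeg_nonempty φ) (by
    rintro _ ⟨s, rfl, hs⟩
    exact_mod_cast Provable.rat_le_rat hT (hs.imp_trans h))

theorem provDeg_rat (hT : Consistent T) (r : UnitRat) : provDeg T (rat r) = ((r.1 : ℚ) : ℝ) :=
  le_antisymm (provDeg_le (Provable.imp_self _)) (le_provDeg hT (Provable.imp_self _))

/-- Otherwise linear completeness would prove `r̄ → φ` and push the degree down to `r`. -/
theorem provable_of_lt_provDeg (hlin : LinearComplete T) {r : UnitRat} {φ : Formula L}
    (hφ : φ.IsSentence) (h : ((r.1 : ℚ) : ℝ) < provDeg T φ) : Provable T (imp φ (rat r)) :=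
  (hlin φ (rat r) hφ fun _ h => h).resolve_right fun h' => absurd (provDeg_le h') (not_le.2 h)

theorem exists_unitRat_btwn {x y : ℝ} (h : x < y) (hx : 0 ≤ x) (hy : y ≤ 1) :
    ∃ r : UnitRat, x < ((r.1 : ℚ) : ℝ) ∧ ((r.1 : ℚ) : ℝ) < y := by
  obtain ⟨q, h1, h2⟩ := exists_rat_btwn h
  refine ⟨⟨q, ?_, ?_⟩, h1, h2⟩
  · exact_mod_cast (hx.trans_lt h1).le
  · exact_mod_cast (h2.trans_le hy).le

theorem exists_provable_imp_rat (hlin : LinearComplete T) {φ : Formula L} (hφ : φ.IsSentence)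
    {x : ℝ} (h : x < provDeg T φ) :
    ∃ r : UnitRat, x < ((r.1 : ℚ) : ℝ) ∧ Provable T (imp φ (rat r)) := by
  rcases lt_or_ge x 0 with hx | hx
  · exact ⟨⟨0, le_rfl, zero_le_one⟩, by simpa using hx, Provable.rat_zero.imp_intro _⟩
  · obtain ⟨r, h1, h2⟩ := exists_unitRat_btwn h hx (provDeg_le_one φ)
    exact ⟨r, h1, provable_of_lt_provDeg hlin hφ h2⟩

theorem UnitRat.coe_tsub (s r : UnitRat) :
    (((s.tsub r).1 : ℚ) : ℝ) = max (((s.1 : ℚ) : ℝ) - ((r.1 : ℚ) : ℝ)) 0 := by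
  simp [UnitRat.tsub]

/-- Implication is antitone on the left and monotone on the right. From `φ → ū` and `w̄ → ψ` one
gets `(ū → w̄) → (φ → ψ)`; from `v̄ → φ` and `ψ → z̄` one gets `(φ → ψ) → (v̄ → z̄)`. Bookkeeping
evaluates the implications between constants, which approximate the two degrees within `ε / 2`. -/
theorem provDeg_imp (hT : Consistent T) (hlin : LinearComplete T) {φ ψ : Formula L}
    (hφ : φ.IsSentence) (hψ : ψ.IsSentence) :
    provDeg T (imp φ ψ) = max (provDeg T ψ - provDeg T φ) 0 := by
  apply le_antisymm
  · refine le_of_forall_pos_le_add fun ε hε => ?_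
    obtain ⟨w, hw, hw'⟩ := exists_provable_of_provDeg_lt
      (show provDeg T ψ < provDeg T ψ + ε / 2 by linarith)
    obtain ⟨u, hu, hu'⟩ := exists_provable_imp_rat hlin hφ
      (show provDeg T φ - ε / 2 < provDeg T φ by linarith)
    refine (provDeg_le (r := w.tsub u) ?_).trans ?_
    · exact (Provable.imp_of_tsub u w).imp_trans ((hu'.imp_left _).imp_trans (hw'.imp_right _))
    · rw [UnitRat.coe_tsub]
      refine max_le ?_ ?_
      · linarith [le_max_left (provDeg T ψ - provDeg T φ) 0]
      · linarith [le_max_right (provDeg T ψ - provDeg T φ) 0]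
  · refine max_le ?_ (provDeg_nonneg _)
    refine le_of_forall_pos_le_add fun ε hε => ?_
    obtain ⟨v, hv, hv'⟩ := exists_provable_of_provDeg_lt
      (show provDeg T φ < provDeg T φ + ε / 2 by linarith)
    obtain ⟨z, hz, hz'⟩ := exists_provable_imp_rat hlin hψ
      (show provDeg T ψ - ε / 2 < provDeg T ψ by linarith)
    have := le_provDeg hT (r := z.tsub v) (φ := imp φ ψ)
      (((hv'.imp_left _).imp_trans (hz'.imp_right _)).imp_trans (Provable.tsub_of_imp v z))
    rw [UnitRat.coe_tsub] at this
    linarith [le_max_left (((z.1 : ℚ) : ℝ) - ((v.1 : ℚ) : ℝ)) 0]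

theorem provDeg_subst_le {x : ℕ} {φ : Formula L} {t : Term L} (h : FreeFor t x φ) :
    provDeg T (φ.subst x t) ≤ provDeg T (all x φ) :=
  provDeg_anti (.all1 x φ t h)

/-- In a linear-complete Henkin theory, the degree of a universal sentence is approximated by its
instances at constants. -/
theorem exists_const_le_provDeg (hT : Consistent T) (hlin : LinearComplete T) (hH : IsHenkin T)
    {x : ℕ} {φ : Formula L} (hφ : (all x φ).IsSentence) {r : UnitRat}
    (h : ((r.1 : ℚ) : ℝ) < provDeg T (all x φ)) :
    ∃ c : L.Const, ((r.1 : ℚ) : ℝ) ≤ provDeg T (φ.subst x (Term.const c)) := by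
  -- A witness `c` of this existential sentence makes `φ[c/x] → r̄` provable, which is a lower bound
  -- for the degree.
  have h1 : Provable T (ex x (imp φ (rat r))) :=
    Provable.ex_imp (fun h => h) (provable_of_lt_provDeg hlin hφ h)
  obtain ⟨c, hc⟩ := hH x (imp φ (rat r)) (fun y hy => by
    simp only [ex, neg, Free, bot, or_false] at hy
    exact hφ y ⟨hy.1, hy.2⟩) h1
  exact ⟨c, le_provDeg hT hc⟩

/-- Any provable existential sentence yields a constant; here `∃x (⊥ → ⊥)`. -/
theorem nonempty_const (hH : IsHenkin T) : Nonempty L.Const := by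
  obtain ⟨c, -⟩ := hH 0 (imp bot bot) (fun y hy => by simp [ex, neg, Free, bot] at hy)
    (Provable.ex_imp (fun h => h) (.all1 0 bot (Term.var 0) trivial))
  exact ⟨c⟩

section Similarity

variable {s t u : Term L}

/-- The similarity axioms speak of variables; their instances at closed terms come from simultaneous
substitution. -/
theorem Provable.sim_refl (hs : ∀ x, ¬ s.Occurs x) : Provable T (sim s s) :=
  (Provable.refl 0).msub (σ := fun _ => s) fun _ => hs

theorem Provable.sim_symm (hs : ∀ x, ¬ s.Occurs x) (ht : ∀ x, ¬ t.Occurs x) :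
    Provable T (imp (sim s t) (sim t s)) :=
  (Provable.symm 0 1).msub (σ := fun | 0 => s | _ => t) (by rintro (_ | _); exacts [hs, ht])

theorem Provable.sim_trans (hs : ∀ x, ¬ s.Occurs x) (ht : ∀ x, ¬ t.Occurs x)
    (hu : ∀ x, ¬ u.Occurs x) : Provable T (imp (sim s t) (imp (sim t u) (sim s u))) :=
  ((Provable.trans 0 1 2).msub (σ := fun | 0 => s | 1 => t | _ => u)
    (by rintro (_ | _ | _); exacts [hs, ht, hu])).oplus_curry

theorem provDeg_sim_self (hs : ∀ x, ¬ s.Occurs x) : provDeg T (sim s s) = 0 :=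
  provDeg_of_provable (.sim_refl hs)

theorem provDeg_sim_comm (hs : ∀ x, ¬ s.Occurs x) (ht : ∀ x, ¬ t.Occurs x) :
    provDeg T (sim s t) = provDeg T (sim t s) :=
  le_antisymm (provDeg_anti (.sim_symm ht hs)) (provDeg_anti (.sim_symm hs ht))

/-- Curried transitivity gives `|t ≈ u → s ≈ u| ≤ |s ≈ t|`, and the left side is at least `|s ≈ u| -
|t ≈ u|`. -/
theorem provDeg_sim_triangle (hT : Consistent T) (hlin : LinearComplete T)
    (hs : ∀ x, ¬ s.Occurs x) (ht : ∀ x, ¬ t.Occurs x) (hu : ∀ x, ¬ u.Occurs x) :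
    provDeg T (sim s u) ≤ provDeg T (sim s t) + provDeg T (sim t u) := by
  have h := provDeg_anti (T := T) (.sim_trans hs ht hu)
  have h1 : (sim t u).IsSentence := fun x hx => Or.elim hx (ht x) (hu x)
  have h2 : (sim s u).IsSentence := fun x hx => Or.elim hx (hs x) (hu x)
  rw [provDeg_imp hT hlin h1 h2] at h
  linarith [le_max_left (provDeg T (sim s u) - provDeg T (sim t u)) 0]

theorem provDeg_sim_congr (hT : Consistent T) (hlin : LinearComplete T) {s' t' : Term L}
    (hs : ∀ x, ¬ s.Occurs x) (ht : ∀ x, ¬ t.Occurs x) (hs' : ∀ x, ¬ s'.Occurs x)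
    (ht' : ∀ x, ¬ t'.Occurs x) (h1 : provDeg T (sim s s') = 0) (h2 : provDeg T (sim t t') = 0) :
    provDeg T (sim s t) = provDeg T (sim s' t') := by
  have a1 := provDeg_sim_triangle hT hlin hs hs' ht
  have a2 := provDeg_sim_triangle hT hlin hs' ht' ht
  have a3 := provDeg_sim_triangle hT hlin hs' hs ht'
  have a4 := provDeg_sim_triangle hT hlin hs ht ht'
  have b1 := provDeg_sim_comm (T := T) hs hs'
  have b2 := provDeg_sim_comm (T := T) ht ht'
  exact le_antisymm (by linarith) (by linarith)

end Similarity

end Degree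

/-! ### The truth lemma, common to both models. -/

namespace Struc

variable {M : Type}

/-- The elements of a structure are named by closed terms, among which are all constants, and the
degrees of atomic formulas are the provability degrees of their instances at the names. -/
structure Named (T : Set (Formula L)) (S : Struc L M) (τ : M → Term L) : Prop where
  closed : ∀ a x, ¬ (τ a).Occurs x
  const : ∀ c : L.Const, ∃ a, τ a = Term.const c
  sim : ∀ (s t : Term L) (v : ℕ → M), (S.sim (S.termVal v s) (S.termVal v t) : ℝ) =
    provDeg T (Formula.sim (s.msub fun i => τ (v i)) (t.msub fun i => τ (v i)))
  rel : ∀ (R : L.Rel) (a : Fin (L.relArity R.1) → Term L) (v : ℕ → M),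
    (S.rel R (fun i => S.termVal v (a i)) : ℝ) =
      provDeg T (Formula.rel R fun j => (a j).msub fun i => τ (v i))

namespace Named

variable {S : Struc L M} {τ : M → Term L}

/-- The truth degree of a formula is the provability degree of its instance at the names. -/
theorem eval_eq (h : S.Named T τ) (hT : Consistent T) (hlin : LinearComplete T) (hH : IsHenkin T)
    (φ : Formula L) (v : ℕ → M) : S.eval φ v = provDeg T (φ.msub fun i => τ (v i)) := by
  have hcl : ∀ (v : ℕ → M) z x, ¬ (τ (v z)).Occurs x := fun v z => h.closed _
  induction φ generalizing v with
  | rat r => exact (provDeg_rat hT r).symm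
  | sim s t => exact h.sim s t v
  | rel R a => exact h.rel R a v
  | imp φ ψ h1 h2 =>
    simp only [Struc.eval, h1, h2, Formula.msub]
    rw [provDeg_imp hT hlin (isSentence_msub (hcl v) φ) (isSentence_msub (hcl v) ψ)]
  | all y φ ih =>
    have := S.nonempty
    simp only [Struc.eval, ih]
    set σ : ℕ → Term L := fun i => τ (v i) with hσ
    -- Changing the evaluation at `y` to `a` amounts to instantiating the quantified formula at the
    -- name of `a`.
    have hsub : ∀ a, (φ.msub fun i => τ (Function.update v y a i)) =
        (φ.msub (Function.update σ y (Term.var y))).subst y (τ a) := by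
      intro a
      rw [Formula.subst_msub, Function.update_idem]
      · congr 1
        funext i
        by_cases hi : i = y
        · subst hi; simp
        · simp [hi, hσ]
      · intro z hz
        simpa [hz] using hcl v z y
      · simp
    have hsent : (Formula.all y (φ.msub (Function.update σ y (Term.var y)))).IsSentence :=
      isSentence_msub (hcl v) (Formula.all y φ)
    simp only [hsub]
    have hbdd : BddAbove (Set.range fun a =>
        provDeg T ((φ.msub (Function.update σ y (Term.var y))).subst y (τ a))) :=
      ⟨1, by rintro _ ⟨a, rfl⟩; exact provDeg_le_one _⟩
    -- Instances lie below the universal sentence by `all1`. Conversely, for each rational below its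
    -- degree the Henkin property provides a constant whose instance has at least that degree, and
    -- constants name elements.
    apply le_antisymm
    · exact ciSup_le fun a => provDeg_subst_le (freeFor_of_closed (h.closed a) _ _)
    · refine le_of_forall_lt fun x hx => ?_
      rcases lt_or_ge x 0 with h0 | h0
      · exact h0.trans_le (le_ciSup_of_le hbdd (Classical.arbitrary M) (provDeg_nonneg _))
      · obtain ⟨r, h1, h2⟩ := exists_unitRat_btwn hx h0 (provDeg_le_one _)
        obtain ⟨c, hc⟩ := exists_const_le_provDeg hT hlin hH hsent h2
        obtain ⟨a, ha⟩ := h.const c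
        rw [← ha] at hc
        exact h1.trans_le (hc.trans (le_ciSup hbdd a))

theorem models (h : S.Named T τ) (hT : Consistent T) (hlin : LinearComplete T) (hH : IsHenkin T) :
    S.Models T := fun φ hφ v => by
  rw [h.eval_eq hT hlin hH]
  exact provDeg_of_provable ((Provable.ax hφ).msub fun _ => h.closed _)

theorem degree_eq (h : S.Named T τ) (hT : Consistent T) (hlin : LinearComplete T)
    (hH : IsHenkin T) {φ : Formula L} (hφ : φ.IsSentence) : S.degree φ = provDeg T φ := by
  have := S.nonempty
  have h1 : ∀ v, S.eval φ v = provDeg T φ := fun v => by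
    rw [h.eval_eq hT hlin hH, Formula.msub_congr (σ' := Term.var) fun x hx => absurd hx (hφ x),
      Formula.msub_var]
  simp [Struc.degree, h1]

end Named

end Struc

end RPL

/-! ### Enumerability of the elementary diagram. -/

namespace RPL

variable {L : Lang} {T : Set (Formula L)}

open Formula

/-- Relative to `[0,1]` the endpoint `0` imposes no condition. Any other `p` must lie strictly below
`x`, since there are points of `[0,1]` arbitrarily close below `p`. -/
theorem Ici_mem_nhdsWithin_unit {p x : ℝ} (hp : 0 ≤ p) (hx : x ∈ Set.Icc (0 : ℝ) 1) :
    Set.Ici p ∈ 𝓝[Set.Icc (0 : ℝ) 1] x ↔ p = 0 ∨ p < x := by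
  constructor
  · intro h
    by_contra! hc
    have hpx : p = x := le_antisymm (mem_of_mem_nhdsWithin hx h) hc.2
    obtain ⟨ε, hε, hsub⟩ := Metric.mem_nhdsWithin_iff.1 h
    have hp0 : 0 < p := lt_of_le_of_ne hp (Ne.symm hc.1)
    -- The minimum keeps the point both in `[0,1]` and in the ball.
    have hm : p - min p (ε / 2) ∈ Set.Ici p := by
      have h1 := min_le_left p (ε / 2)
      have h2 := min_le_right p (ε / 2)
      have h3 : 0 < min p (ε / 2) := lt_min hp0 (half_pos hε)
      refine hsub ⟨?_, by linarith, by linarith [hx.2]⟩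
      rw [Metric.mem_ball, Real.dist_eq, ← hpx, abs_lt]
      constructor <;> linarith
    have h3 : 0 < min p (ε / 2) := lt_min hp0 (half_pos hε)
    have := Set.mem_Ici.1 hm
    linarith
  · rintro (rfl | h)
    · exact Filter.mem_of_superset self_mem_nhdsWithin fun y hy => hy.1
    · exact mem_nhdsWithin_of_mem_nhds (Ici_mem_nhds h)

theorem Iic_mem_nhdsWithin_unit {q x : ℝ} (hq : q ≤ 1) (hx : x ∈ Set.Icc (0 : ℝ) 1) :
    Set.Iic q ∈ 𝓝[Set.Icc (0 : ℝ) 1] x ↔ q = 1 ∨ x < q := by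
  constructor
  · intro h
    by_contra! hc
    have hpx : x = q := le_antisymm (Set.mem_Iic.1 (mem_of_mem_nhdsWithin hx h)) hc.2
    obtain ⟨ε, hε, hsub⟩ := Metric.mem_nhdsWithin_iff.1 h
    have hq1 : q < 1 := lt_of_le_of_ne hq hc.1
    have h3 : 0 < min (1 - q) (ε / 2) := lt_min (by linarith) (half_pos hε)
    have hm : q + min (1 - q) (ε / 2) ∈ Set.Iic q := by
      have h1 := min_le_left (1 - q) (ε / 2)
      have h2 := min_le_right (1 - q) (ε / 2)
      refine hsub ⟨?_, by linarith [hx.1], by linarith⟩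
      rw [Metric.mem_ball, Real.dist_eq, hpx, abs_lt]
      constructor <;> linarith
    have := Set.mem_Iic.1 hm
    linarith
  · rintro (rfl | h)
    · exact Filter.mem_of_superset self_mem_nhdsWithin fun y hy => hy.2
    · exact mem_nhdsWithin_of_mem_nhds (Iic_mem_nhds h)

theorem approximates_iff {p q : UnitRat} {x : ℝ} (hx : x ∈ Set.Icc (0 : ℝ) 1) :
    Approximates p q x ↔ (p.1 = 0 ∨ ((p.1 : ℚ) : ℝ) < x) ∧ (q.1 = 1 ∨ x < ((q.1 : ℚ) : ℝ)) := by
  rw [Approximates, ← Set.Ici_inter_Iic (a := ((p.1 : ℚ) : ℝ)), Filter.inter_mem_iff,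
    Ici_mem_nhdsWithin_unit (by exact_mod_cast p.2.1) hx,
    Iic_mem_nhdsWithin_unit (by exact_mod_cast q.2.2) hx]
  norm_cast

namespace UnitRat

theorem lt_iff (r s : UnitRat) : r.1 < s.1 ↔
    r.code.unpair.1 * s.code.unpair.2 < s.code.unpair.1 * r.code.unpair.2 := by
  have hr : (0 : ℚ) < r.1.den := by exact_mod_cast r.1.den_pos
  have hs : (0 : ℚ) < s.1.den := by exact_mod_cast s.1.den_pos
  simp only [code, Nat.unpair_pair]
  rw [← Nat.cast_lt (α := ℚ)]
  push_cast
  rw [← val_mul_den r, ← val_mul_den s,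
    show r.1 * r.1.den * s.1.den = r.1 * (r.1.den * s.1.den) by ring,
    show s.1 * s.1.den * r.1.den = s.1 * (r.1.den * s.1.den) by ring,
    mul_lt_mul_iff_left₀ (by positivity)]

theorem eq_zero_iff (r : UnitRat) : r.1 = 0 ↔ r.code.unpair.1 = 0 := by
  simp [code]

theorem eq_one_iff (r : UnitRat) : r.1 = 1 ↔ r.code.unpair.1 = r.code.unpair.2 := by
  have hr : (0 : ℚ) < r.1.den := by exact_mod_cast r.1.den_pos
  simp only [code, Nat.unpair_pair]
  rw [← Nat.cast_inj (R := ℚ), ← val_mul_den r, mul_eq_right₀ hr.ne']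

end UnitRat

/-- The right side is existential over theorems, so strict lower bounds are enumerable; the dual for
upper bounds is `provDeg_lt_iff`. -/
theorem lt_provDeg_iff (hT : Consistent T) (hlin : LinearComplete T) {φ : Formula L}
    (hφ : φ.IsSentence) (p : UnitRat) : ((p.1 : ℚ) : ℝ) < provDeg T φ ↔
      ∃ r : UnitRat, p.1 < r.1 ∧ Provable T (imp φ (rat r)) := by
  constructor
  · intro h
    obtain ⟨r, h1, h2⟩ := exists_provable_imp_rat hlin hφ h
    exact ⟨r, by exact_mod_cast h1, h2⟩
  · rintro ⟨r, h1, h2⟩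
    exact lt_of_lt_of_le (by exact_mod_cast h1) (le_provDeg hT h2)

theorem provDeg_lt_iff {φ : Formula L} (q : UnitRat) : provDeg T φ < ((q.1 : ℚ) : ℝ) ↔
      ∃ r : UnitRat, r.1 < q.1 ∧ Provable T (imp (rat r) φ) := by
  constructor
  · intro h
    obtain ⟨r, h1, h2⟩ := exists_provable_of_provDeg_lt h
    exact ⟨r, by exact_mod_cast h1, h2⟩
  · rintro ⟨r, h1, h2⟩
    exact lt_of_le_of_lt (provDeg_le h2) (by exact_mod_cast h1)

theorem provable_code_iff {φ : Formula L} :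
    (∃ ψ, Provable T ψ ∧ ψ.code = φ.code) ↔ Provable T φ :=
  ⟨fun ⟨_, h, hc⟩ => code_injective hc ▸ h, fun h => ⟨φ, h, rfl⟩⟩

/-- Gödel numbers of sentences and of the endpoints of rational intervals that approximate their
provability degrees, as a predicate on numbers. -/
def ApproxCode (T : Set (Formula L)) (w : ℕ × ℕ × ℕ) : Prop :=
  (w.2.1.unpair.1 = 0 ∨ ∃ r : ℕ, (UnitRat.isCode r = true ∧
      w.2.1.unpair.1 * r.unpair.2 < r.unpair.1 * w.2.1.unpair.2) ∧
      ∃ ψ, Provable T ψ ∧ ψ.code = impCode w.1 (Nat.pair 0 r)) ∧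
  (w.2.2.unpair.1 = w.2.2.unpair.2 ∨ ∃ r : ℕ, (UnitRat.isCode r = true ∧
      r.unpair.1 * w.2.2.unpair.2 < w.2.2.unpair.1 * r.unpair.2) ∧
      ∃ ψ, Provable T ψ ∧ ψ.code = impCode (Nat.pair 0 r) w.1)

theorem approxCode_iff (hT : Consistent T) (hlin : LinearComplete T) {φ : Formula L}
    (hφ : φ.IsSentence) (p q : UnitRat) :
    ApproxCode T (φ.code, p.code, q.code) ↔ Approximates p q (provDeg T φ) := by
  rw [approximates_iff ⟨provDeg_nonneg φ, provDeg_le_one φ⟩, lt_provDeg_iff hT hlin hφ,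
    provDeg_lt_iff, UnitRat.eq_zero_iff, UnitRat.eq_one_iff, ApproxCode]
  have h1 : ∀ r : UnitRat, (∃ ψ, Provable T ψ ∧ ψ.code = impCode φ.code (Nat.pair 0 r.code)) ↔
      Provable T (imp φ (rat r)) := fun r => by rw [← provable_code_iff, code_imp, code_rat]
  have h2 : ∀ r : UnitRat, (∃ ψ, Provable T ψ ∧ ψ.code = impCode (Nat.pair 0 r.code) φ.code) ↔
      Provable T (imp (rat r) φ) := fun r => by rw [← provable_code_iff, code_imp, code_rat]
  refine and_congr (or_congr_right ⟨?_, ?_⟩) (or_congr_right ⟨?_, ?_⟩)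
  · rintro ⟨n, ⟨hn, hlt⟩, h⟩
    obtain ⟨r, rfl⟩ := UnitRat.isCode_iff.1 hn
    exact ⟨r, (UnitRat.lt_iff _ _).2 hlt, (h1 r).1 h⟩
  · rintro ⟨r, hlt, h⟩
    exact ⟨r.code, ⟨UnitRat.isCode_iff.2 ⟨r, rfl⟩, (UnitRat.lt_iff _ _).1 hlt⟩, (h1 r).2 h⟩
  · rintro ⟨n, ⟨hn, hlt⟩, h⟩
    obtain ⟨r, rfl⟩ := UnitRat.isCode_iff.1 hn
    exact ⟨r, (UnitRat.lt_iff _ _).2 hlt, (h2 r).1 h⟩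
  · rintro ⟨r, hlt, h⟩
    exact ⟨r.code, ⟨UnitRat.isCode_iff.2 ⟨r, rfl⟩, (UnitRat.lt_iff _ _).1 hlt⟩, (h2 r).2 h⟩

theorem rePred_approxCode (hL : L.ComputablyGiven) (hax : ComputablyAxiomatizable T) :
    REPred (ApproxCode T) := by
  have hP := rePred_provable hL hax
  have b1 : REPred fun w : ℕ × ℕ × ℕ => w.2.1.unpair.1 = 0 :=
    (REPred.of_computable (q := fun w : ℕ × ℕ × ℕ => w.2.1.unpair.1 == 0)
      (by fun_prop)).of_eq fun w => by simp
  have b2 : REPred fun w : ℕ × ℕ × ℕ => w.2.2.unpair.1 = w.2.2.unpair.2 :=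
    (REPred.of_computable (q := fun w : ℕ × ℕ × ℕ => w.2.2.unpair.1 == w.2.2.unpair.2)
      (by fun_prop)).of_eq fun w => by simp
  have c1 : REPred fun x : (ℕ × ℕ × ℕ) × ℕ => UnitRat.isCode x.2 = true ∧
      x.1.2.1.unpair.1 * x.2.unpair.2 < x.2.unpair.1 * x.1.2.1.unpair.2 :=
    (REPred.of_computable (q := fun x : (ℕ × ℕ × ℕ) × ℕ => UnitRat.isCode x.2 &&
      (x.1.2.1.unpair.1 * x.2.unpair.2 + 1).ble (x.2.unpair.1 * x.1.2.1.unpair.2))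
      (by fun_prop)).of_eq fun w => by simp
  have c2 : REPred fun x : (ℕ × ℕ × ℕ) × ℕ => UnitRat.isCode x.2 = true ∧
      x.2.unpair.1 * x.1.2.2.unpair.2 < x.1.2.2.unpair.1 * x.2.unpair.2 :=
    (REPred.of_computable (q := fun x : (ℕ × ℕ × ℕ) × ℕ => UnitRat.isCode x.2 &&
      (x.2.unpair.1 * x.1.2.2.unpair.2 + 1).ble (x.1.2.2.unpair.1 * x.2.unpair.2))
      (by fun_prop)).of_eq fun w => by simp
  have d1 := hP.comp (f := fun x : (ℕ × ℕ × ℕ) × ℕ => impCode x.1.1 (Nat.pair 0 x.2)) (by fun_prop)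
  have d2 := hP.comp (f := fun x : (ℕ × ℕ × ℕ) × ℕ => impCode (Nat.pair 0 x.2) x.1.1) (by fun_prop)
  exact (b1.or (REPred.proj (c1.and d1))).and (b2.or (REPred.proj (c2.and d2)))

/-- Successive substitution, on Gödel numbers, of the terms with the Gödel numbers `c a`, for `a` in
the list, for the variables `0, 1, …`. -/
noncomputable def instCode (L : Lang) (c : ℕ → ℕ) (m : ℕ) (l : List ℕ) : ℕ × ℕ :=
  -- The state is the next variable and the current code. The default `0` is never used when `m`
  -- codes a formula.
  l.foldl (fun s a => (s.1 + 1, ((Formula.data L (s.1, c a, []) s.2).map fun r => r.1).getD 0))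
    (0, m)

theorem computable_instCode (hL : L.ComputablyGiven) {c : ℕ → ℕ} (hc : Computable c) :
    Computable fun x : ℕ × List ℕ => instCode L c x.1 x.2 := by
  have := Formula.computable_data hL
  unfold instCode
  fun_prop

theorem instCode_eq {c f : ℕ → ℕ} {σ : ℕ → Term L} (hσ : ∀ z x, ¬ (σ z).Occurs x)
    (h : ∀ i, c (f i) = (σ i).code) (φ : Formula L) (n : ℕ) :
    instCode L c φ.code ((List.range n).map f) = (n, (φ.msub (truncSub σ n)).code) := by
  induction n with
  | zero =>
    have : truncSub σ 0 = Term.var := funext fun i => by simp [truncSub]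
    simp [instCode, this, Formula.msub_var]
  | succ n ih =>
    unfold instCode at ih ⊢
    rw [List.range_succ, List.map_append, List.foldl_append, ih, Formula.msub_truncSub_succ hσ]
    simp [h, Formula.data_code, substCode_code]

/-- Well-formedness of the data is decidable; by the truth lemma the rest is `ApproxCode` of the
sentence in which the names replace the parameters. The function `c` turns the number of an element
into the Gödel number of its name. -/
theorem Struc.Named.rePred_diagram {M : Type} {S : Struc L M} {τ : M → Term L}
    (h : S.Named T τ) (hT : Consistent T) (hlin : LinearComplete T) (hH : IsHenkin T)
    (hL : L.ComputablyGiven) (hax : ComputablyAxiomatizable T) {ν : M → ℕ}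
    (hν : ComputablePred fun n => ∃ a, ν a = n) {c : ℕ → ℕ} (hc : Computable c)
    (hcν : ∀ a, c (ν a) = (τ a).code) :
    REPred fun w : ℕ × List ℕ × ℕ × ℕ =>
      ∃ (φ : Formula L) (n : ℕ) (v : ℕ → M) (p q : UnitRat),
        (∀ x, φ.Free x → x < n) ∧
        w = (φ.code, (List.range n).map (fun i => ν (v i)), p.code, q.code) ∧
        Approximates p q (S.eval φ v) := by
  obtain ⟨u, hu, hu'⟩ := ComputablePred.computable_iff.1 hν
  have hu'' : ∀ n, u n = true ↔ ∃ a, ν a = n := fun n => (congrFun hu' n ▸ Iff.rfl)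
  have hd := Formula.computable_data hL
  have hi := computable_instCode hL hc
  have g1 : REPred fun w : ℕ × List ℕ × ℕ × ℕ =>
      (w.2.1.all u && (UnitRat.isCode w.2.2.1 && (UnitRat.isCode w.2.2.2 &&
        (Formula.data L (0, 0, []) w.1).elim false
          fun r => r.2.1.all fun x => (x + 1).ble w.2.1.length))) = true :=
    REPred.of_computable (by fun_prop)
  have g2 := (rePred_approxCode hL hax).comp (f := fun w : ℕ × List ℕ × ℕ × ℕ =>
    ((instCode L c w.1 w.2.1).2, w.2.2.1, w.2.2.2)) (by fun_prop)
  refine (g1.and g2).of_eq ?_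
  have key : ∀ (φ : Formula L) (n : ℕ) (v : ℕ → M) (p q : UnitRat), (∀ x, φ.Free x → x < n) →
      (ApproxCode T ((instCode L c φ.code ((List.range n).map fun i => ν (v i))).2,
        p.code, q.code) ↔ Approximates p q (S.eval φ v)) := by
    intro φ n v p q hn
    have hcl : ∀ z x, ¬ (τ (v z)).Occurs x := fun z => h.closed _
    rw [instCode_eq (σ := fun i => τ (v i)) hcl (fun i => hcν (v i)), Formula.msub_truncSub hn,
      approxCode_iff hT hlin (isSentence_msub hcl φ), h.eval_eq hT hlin hH]
  rintro ⟨m, l, a, b⟩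
  constructor
  · rintro ⟨h1, h2⟩
    simp only [Bool.and_eq_true, List.all_eq_true, hu'', UnitRat.isCode_iff] at h1
    obtain ⟨hl, ⟨p, rfl⟩, ⟨q, rfl⟩, hm⟩ := h1
    cases hm' : Formula.data L (0, 0, []) m with
    | none => simp [hm'] at hm
    | some r =>
    obtain ⟨φ, rfl⟩ := Formula.isSome_data.1 (Option.isSome_of_mem hm')
    simp only [Formula.data_code, Option.elim_some, List.all_eq_true, Nat.ble_eq, mem_fv,
      Nat.succ_le_iff] at hm
    -- Only the first `l.length` values of the evaluation matter; beyond them it is arbitrary.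
    have hx : ∀ i, ∃ x : M, ∀ hi : i < l.length, ν x = l[i] := by
      intro i
      by_cases hi : i < l.length
      · obtain ⟨x, hx⟩ := hl _ (List.getElem_mem hi)
        exact ⟨x, fun _ => hx⟩
      · exact ⟨S.nonempty.some, fun hi' => absurd hi' hi⟩
    choose v hv using hx
    have hlv : l = (List.range l.length).map fun i => ν (v i) := by
      apply List.ext_getElem
      · simp
      · intro i hi _
        simp [hv i hi]
    refine ⟨φ, l.length, v, p, q, hm, by rw [← hlv], ?_⟩
    rw [← key φ l.length v p q hm, ← hlv]
    exact h2
  · rintro ⟨φ, n, v, p, q, hn, hw, happ⟩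
    obtain ⟨rfl, rfl, rfl, rfl⟩ : m = φ.code ∧ l = (List.range n).map (fun i => ν (v i)) ∧
      a = p.code ∧ b = q.code := by simpa using hw
    refine ⟨?_, (key φ n v p q hn).2 happ⟩
    simp only [Bool.and_eq_true, List.all_eq_true, hu'', UnitRat.isCode_iff]
    refine ⟨?_, ⟨p, rfl⟩, ⟨q, rfl⟩, ?_⟩
    · intro x hx
      obtain ⟨i, -, rfl⟩ := List.mem_map.1 hx
      exact ⟨v i, rfl⟩
    · simpa [Formula.data_code, List.all_eq_true, mem_fv, Nat.succ_le_iff] using hn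

end RPL

/-! ### The structures on closed terms and on constants. -/

namespace RPL

variable {L : Lang} {T : Set (Formula L)}

open Formula

/-- The provability degree, as an element of the unit interval. -/
noncomputable def provDegUnit (T : Set (Formula L)) (φ : Formula L) : unitInterval :=
  ⟨provDeg T φ, provDeg_nonneg φ, provDeg_le_one φ⟩

theorem Term.msub_closed {σ : ℕ → Term L} (hσ : ∀ z x, ¬ (σ z).Occurs x) (t : Term L) (x : ℕ) :
    ¬ (t.msub σ).Occurs x := fun h => by
  obtain ⟨z, -, hz⟩ := Term.occurs_msub h
  exact hσ _ _ hz

/-- The term structure of a theory whose language has a constant. -/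
noncomputable def termStruc (T : Set (Formula L)) (hc : Nonempty L.Const) :
    Struc L (ClosedTerm L) where
  nonempty := hc.map fun c => ⟨Term.const c, fun _ h => h⟩
  const c := ⟨Term.const c, fun _ h => h⟩
  func f a := ⟨Term.func f fun i => (a i).1, fun x ⟨i, h⟩ => (a i).2 x h⟩
  sim s t := provDegUnit T (sim s.1 t.1)
  rel R a := provDegUnit T (rel R fun i => (a i).1)

theorem termStruc_termVal (hc : Nonempty L.Const) (v : ℕ → ClosedTerm L) (t : Term L) :
    ((termStruc T hc).termVal v t).1 = t.msub fun i => (v i).1 := by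
  induction t with
  | var x => rfl
  | const c => rfl
  | func f a ih => exact congrArg (Term.func f) (funext ih)

theorem termStruc_named (hc : Nonempty L.Const) :
    (termStruc T hc).Named T (fun t => t.1) where
  closed t := t.2
  const c := ⟨⟨Term.const c, fun _ h => h⟩, rfl⟩
  sim s t v := by
    rw [← termStruc_termVal hc (T := T), ← termStruc_termVal hc (T := T)]
    rfl
  rel R a v := by
    simp only [← termStruc_termVal hc (T := T)]
    rfl

theorem Provable.ex_intro {x : ℕ} {φ : Formula L} {t : Term L} (ht : FreeFor t x φ)
    (h : Provable T (φ.subst x t)) : Provable T (ex x φ) :=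
  h.mp (swap (all1 x (neg φ) t ⟨ht, trivial⟩))

/-- In a Henkin theory, every closed term is provably equal to a constant. -/
theorem exists_const_provable_sim (hH : IsHenkin T) {t : Term L} (ht : ∀ x, ¬ t.Occurs x) :
    ∃ c : L.Const, Provable T (sim t (Term.const c)) := by
  have hs : ∀ s : Term L, (sim t (Term.var 0)).subst 0 s = sim t s := fun s => by
    simp [Formula.subst, Term.subst_of_not_occurs (ht 0), Term.subst]
  -- The term `t` itself is the witness; the Henkin property then replaces it by a constant.
  have h1 : Provable T (ex 0 (sim t (Term.var 0))) :=
    Provable.ex_intro (t := t) trivial (by rw [hs]; exact .sim_refl ht)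
  obtain ⟨c, hc⟩ := hH 0 _ (fun y hy => by
    simp only [ex, neg, Free, bot, or_false, Term.Occurs, ht, false_or] at hy
    exact hy.1 hy.2) h1
  exact ⟨c, by rwa [hs] at hc⟩

/-- Values of the function symbols at constants can be chosen computably among the constants. -/
theorem exists_computable_func (hL : L.ComputablyGiven) (hax : ComputablyAxiomatizable T)
    (hH : IsHenkin T) :
    ∃ (F : (f : L.Func) → (Fin (L.funcArity f.1) → L.Const) → L.Const) (g : ℕ × List ℕ → ℕ),
      (∀ f a, Provable T (sim (Term.func f fun i => Term.const (a i)) (Term.const (F f a)))) ∧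
      Computable g ∧ ∀ f a, g (f.1, List.ofFn fun i => (a i).1) = (F f a).1 := by
  -- `k` sends the numbers of a symbol and of constants to the Gödel number of the applied term.
  let k : ℕ × List ℕ → ℕ := fun x =>
    Nat.pair 2 (Nat.pair x.1 (Encodable.encode (x.2.map fun c => Nat.pair 1 c)))
  have hk : Computable k := by fun_prop
  have hd := Term.computable_data hL
  have hr : REPred fun x : (ℕ × List ℕ) × ℕ =>
      ∃ φ, Provable T φ ∧ φ.code = Nat.pair 1 (Nat.pair (k x.1) (Nat.pair 1 x.2)) :=
    (rePred_provable hL hax).comp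
      (f := fun x : (ℕ × List ℕ) × ℕ => Nat.pair 1 (Nat.pair (k x.1) (Nat.pair 1 x.2)))
      (by fun_prop)
  -- The search looks for a theorem `f(c⃗) ≈ c`. It is required to succeed only where `k` gives the
  -- code of a term; such a term is closed, because its arguments carry the tag of constants.
  obtain ⟨g, hg, hgr⟩ := REPred.exists_choice (r := fun x n =>
      ∃ φ, Provable T φ ∧ φ.code = Nat.pair 1 (Nat.pair (k x) (Nat.pair 1 n))) hr
    (d := fun x => (Term.data L (0, 0) (k x)).isSome) (by fun_prop) (by
      rintro ⟨f, l⟩ hx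
      obtain ⟨t, ht⟩ := Term.isSome_data.1 hx
      have hclosed : ∀ x, ¬ t.Occurs x := by
        cases t with
        | func f' a =>
          simp only [Term.code, k, Nat.pair_eq_pair, true_and] at ht
          have h2 := Encodable.encode_injective ht.2
          rintro x ⟨i, hi⟩
          have h3 : (a i).code ∈ l.map fun c => Nat.pair 1 c := by
            rw [← h2]; exact List.mem_ofFn.2 ⟨i, rfl⟩
          obtain ⟨c, -, hc⟩ := List.mem_map.1 h3
          cases hai : a i <;> rw [hai] at hc hi <;> simp [Term.code] at hc
          exact hi
        | _ => simp [Term.code, k] at ht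
      obtain ⟨c, hc⟩ := exists_const_provable_sim hH hclosed
      exact ⟨c.1, _, hc, by simp only [code_sim, ht]; rfl⟩)
  have hcode : ∀ (f : L.Func) (a : Fin (L.funcArity f.1) → L.Const),
      (Term.func f fun i => Term.const (a i) : Term L).code =
        k (f.1, List.ofFn fun i => (a i).1) := fun f a => by
    simp [k, Term.code, List.map_ofFn, Function.comp_def]
  have key : ∀ (f : L.Func) (a : Fin (L.funcArity f.1) → L.Const), ∃ c : L.Const,
      Provable T (sim (Term.func f fun i => Term.const (a i)) (Term.const c)) ∧
        g (f.1, List.ofFn fun i => (a i).1) = c.1 := by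
    intro f a
    obtain ⟨φ, hφ, hc⟩ := hgr (f.1, List.ofFn fun i => (a i).1)
      (Term.isSome_data.2 ⟨_, hcode f a⟩)
    rw [← hcode] at hc
    -- The tags identify the theorem found as a similarity with a constant on the right, so the
    -- number found is that of a constant.
    cases φ with
    | sim s u =>
      simp only [code_sim, Nat.pair_eq_pair, true_and] at hc
      obtain rfl := Term.code_injective hc.1
      cases u with
      | const c =>
        refine ⟨c, hφ, ?_⟩
        have := hc.2
        simp only [Term.code, Nat.pair_eq_pair, true_and] at this
        exact this.symm
      | _ => simp [Term.code] at hc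
    | _ => simp [code] at hc
  choose F hF hFg using key
  exact ⟨F, g, hF, hg, hFg⟩

/-- The structure on the constants given by a choice of the values of the functions. -/
noncomputable def constStruc (T : Set (Formula L)) (hc : Nonempty L.Const)
    (F : (f : L.Func) → (Fin (L.funcArity f.1) → L.Const) → L.Const) : Struc L L.Const where
  nonempty := hc
  const c := c
  func := F
  sim a b := provDegUnit T (sim (Term.const a) (Term.const b))
  rel R a := provDegUnit T (rel R fun i => Term.const (a i))

/-- The value of a term is a constant at distance `0` from the instance of the term, by induction
through congruence of the functions and the choice of `F`. Degrees of similarity then agree by the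
triangle inequality, those of relations by congruence. Without function symbols, value and instance
coincide. -/
theorem constStruc_named (hT : Consistent T) (hlin : LinearComplete T) (hc : Nonempty L.Const)
    {F : (f : L.Func) → (Fin (L.funcArity f.1) → L.Const) → L.Const}
    (hF : ∀ f a, Provable T (sim (Term.func f fun i => Term.const (a i)) (Term.const (F f a))))
    (hcongr : IsEmpty L.Func ∨ Congruential T) :
    (constStruc T hc F).Named T Term.const := by
  have hcl : ∀ (v : ℕ → L.Const) z x, ¬ (Term.const (v z) : Term L).Occurs x := fun _ _ _ h => h
  have hcl' : ∀ (c : L.Const) x, ¬ (Term.const c : Term L).Occurs x := fun _ _ h => h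
  have key : ∀ (v : ℕ → L.Const) (t : Term L), provDeg T (sim (t.msub fun i => Term.const (v i))
      (Term.const ((constStruc T hc F).termVal v t))) = 0 := by
    intro v t
    induction t with
    | var x => exact provDeg_sim_self (hcl' _)
    | const c => exact provDeg_sim_self (hcl' _)
    | func f a ih =>
      rcases hcongr with hE | hC
      · exact (hE.false f).elim
      have h1 := hC.2 f _ _ (fun i => Term.msub_closed (hcl v) (a i)) (fun i => hcl' _) ih
      have h2 := provDeg_of_provable (hF f fun i => (constStruc T hc F).termVal v (a i))
      have h3 := provDeg_sim_triangle hT hlin (T := T)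
        (s := (Term.func f a).msub fun i => Term.const (v i))
        (t := Term.func f fun i => Term.const ((constStruc T hc F).termVal v (a i)))
        (u := Term.const ((constStruc T hc F).termVal v (Term.func f a)))
        (Term.msub_closed (hcl v) _) (fun x ⟨i, h⟩ => h) (hcl' _)
      refine le_antisymm (h3.trans (le_of_eq ?_)) (provDeg_nonneg _)
      rw [show (0 : ℝ) = 0 + 0 by norm_num]
      exact congrArg₂ _ h1 h2
  refine ⟨hcl', fun c => ⟨c, rfl⟩, fun s t v => ?_, fun R a v => ?_⟩
  · exact (provDeg_sim_congr hT hlin (Term.msub_closed (hcl v) s) (Term.msub_closed (hcl v) t)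
      (hcl' _) (hcl' _) (key v s) (key v t)).symm
  · rcases hcongr with hE | hC
    · have : ∀ t : Term L, (t.msub fun i => Term.const (v i)) =
          Term.const ((constStruc T hc F).termVal v t) := by
        intro t
        cases t with
        | func f a => exact (hE.false f).elim
        | _ => rfl
      simp only [this]
      rfl
    · exact (hC.1 R _ _ (fun i => Term.msub_closed (hcl v) (a i)) (fun i => hcl' _)
        (fun i => key v (a i))).symm

end RPL

/-! ### The two decidable models. -/

theorem theorem3p5 (L : RPL.Lang) (hL : L.ComputablyGiven) (T : Set (RPL.Formula L))
    (hcons : RPL.Consistent T) (hlin : RPL.LinearComplete T)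
    (hax : RPL.ComputablyAxiomatizable T) (hHenkin : RPL.IsHenkin T) :
    -- a decidable model on the closed terms, which denote themselves
    (∃ S : RPL.Struc L (RPL.ClosedTerm L),
      (∀ c, (S.const c).1 = RPL.Term.const c) ∧
      (∀ f a, (S.func f a).1 = RPL.Term.func f fun i => (a i).1) ∧
      (∀ s t, (S.sim s t : ℝ) = RPL.provDeg T (RPL.Formula.sim s.1 t.1)) ∧
      S.SimPseudoMetric ∧
      S.Models T ∧
      (∀ φ : RPL.Formula L, φ.IsSentence → S.degree φ = RPL.provDeg T φ) ∧
      S.DecidableVia (fun t => t.1.code)) ∧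
    -- a decidable model on the constants, which denote themselves
    (IsEmpty L.Func ∨ RPL.Congruential T →
      ∃ S : RPL.Struc L L.Const,
        (∀ c, S.const c = c) ∧
        (∀ f a, RPL.Provable T (RPL.Formula.sim
          (RPL.Term.func f fun i => RPL.Term.const (a i)) (RPL.Term.const (S.func f a)))) ∧
        (∀ a b, (S.sim a b : ℝ) =
          RPL.provDeg T (RPL.Formula.sim (RPL.Term.const a) (RPL.Term.const b))) ∧
        S.SimPseudoMetric ∧
        S.Models T ∧
        (∀ φ : RPL.Formula L, φ.IsSentence → S.degree φ = RPL.provDeg T φ) ∧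
        S.DecidableVia (fun c => c.1)) := by
  have hc := RPL.nonempty_const hHenkin
  constructor
  · have hn := RPL.termStruc_named (T := T) hc
    refine ⟨RPL.termStruc T hc, fun _ => rfl, fun _ _ => rfl, fun _ _ => rfl,
      ⟨fun a => RPL.provDeg_sim_self a.2, fun a b => RPL.provDeg_sim_comm a.2 b.2,
        fun a b c => RPL.provDeg_sim_triangle hcons hlin a.2 b.2 c.2⟩,
      hn.models hcons hlin hHenkin, fun φ hφ => hn.degree_eq hcons hlin hHenkin hφ, ?_⟩
    exact
      { injective := fun s t h => Subtype.ext (RPL.Term.code_injective h)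
        universe_decidable := RPL.Term.computablePred_closed hL
        const := ⟨fun n => Nat.pair 1 n, by fun_prop, fun _ => rfl⟩
        func := ⟨fun x => Nat.pair 2 (Nat.pair x.1 (Encodable.encode x.2)), by fun_prop,
          fun _ _ => rfl⟩
        diagram := hn.rePred_diagram hcons hlin hHenkin hL hax
          (RPL.Term.computablePred_closed hL) (c := fun n => n) (by fun_prop) fun _ => rfl }
  · intro hcongr
    obtain ⟨F, g, hF, hg, hFg⟩ := RPL.exists_computable_func hL hax hHenkin
    have hn := RPL.constStruc_named hcons hlin hc hF hcongr
    have hu : ComputablePred fun n => ∃ a : L.Const, a.1 = n :=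
      hL.const.of_eq fun n => ⟨fun h => ⟨⟨n, h⟩, rfl⟩, by rintro ⟨a, rfl⟩; exact a.2⟩
    refine ⟨RPL.constStruc T hc F, fun _ => rfl, hF, fun _ _ => rfl,
      ⟨fun a => RPL.provDeg_sim_self fun _ h => h,
        fun a b => RPL.provDeg_sim_comm (fun _ h => h) fun _ h => h,
        fun a b c => RPL.provDeg_sim_triangle hcons hlin (fun _ h => h) (fun _ h => h)
          fun _ h => h⟩,
      hn.models hcons hlin hHenkin, fun φ hφ => hn.degree_eq hcons hlin hHenkin hφ, ?_⟩
    exact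
      { injective := Subtype.val_injective
        universe_decidable := hu
        const := ⟨fun n => n, by fun_prop, fun _ => rfl⟩
        func := ⟨g, hg, hFg⟩
        -- Elements are numbered by the constants' own numbers, so the tag `1` is added to reach the
        -- Gödel numbers of their names.
        diagram := hn.rePred_diagram hcons hlin hHenkin hL hax hu (c := fun n => Nat.pair 1 n)
          (by fun_prop) fun _ => rfl }
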